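/- ADFS1 maintains, under insertion of edges into an initially empty undirected graph $G$ on $n$ vertices, a DFS tree $T$ of $G$ augmented by a pseudo root $s$ that is adjacent to all vertices (initially $T$ is the star with centre $s$). It keeps a set of pending edges. When an edge is inserted, it becomes pending; while edges are pending, an arbitrary one of them, $(x,y)$, is removed from the pending set, and $w=\mathrm{LCA}_T(x,y)$ is computed. If $w\in\{x,y\}$, the edge is just added to $G$. Otherwise, naming the endpoints so that $x$ is at least as deep in $T$ as $y$ (ties are broken arbitrarily), and letting $v$ be the child of $w$ with $y\in T(v)$, where $T(v)$ is the subtree rooted at $v$, the algorithm adds $(x,y)$ to $G$, reverses the tree path between $v$ and $y$ and hangs the subtree, now rooted at $y$, from $x$; all edges of $G$ that have thereby become cross edges (neither endpoint is an ancestor of the other) are collected, i.e. moved from $G$ to the pending set. The next edge is inserted when no edge is pending. The running time of an execution is the number of elementary operations, where one operation is charged for each insertion, for each time an edge is processed, for each collected edge, and for each vertex of each rebuilt subtree $T(v)$. Theorem. There are absolute constants $c,C>0$ such that for all integers $n,m\ge 0$ with $n\le m\le\binom n2$: (i) there is a sequence of $m$ insertions of distinct edges into the empty graph on $n$ vertices,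 and an execution of ADFS1 that processes the whole sequence, whose running time $t$ satisfies $c\,n^{3/2}m^{1/2}\le t\le C\,n^{3/2}m^{1/2}$; (ii) on every sequence of $m$ insertions of distinct edges into the empty graph on $n$ vertices, every execution of ADFS1, finished or not, has running time at most $C\,n^{3/2}m^{1/2}$. Hence, over the arbitrary choices of the algorithm, the worst-case time on the sequence in (i) is $\Theta(n^{3/2}m^{1/2})$, and the upper bound $O(n^{3/2}m^{1/2})$ of Baswana and Khan for ADFS1 is tight. -/

import Mathlib

/-!
The incremental depth-first search algorithm ADFS1 for undirected graphs, with a count of its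
elementary operations. The vertex set is `Fin n`, and `none : Option (Fin n)` is the pseudo root
`s`, which is joined to every vertex. A rooted tree `T` is given by its parent function
`par : Fin n → Option (Fin n)`.
-/

namespace ADFS

/-- The parent of a vertex of the augmented tree; the pseudo root is its own parent. -/
def up {n : ℕ} (par : Fin n → Option (Fin n)) : Option (Fin n) → Option (Fin n)
  | none => none
  | some z => par z

/-- `a` is an ancestor of `z` in `T` (every vertex is an ancestor of itself);
equivalently `z` lies in the subtree `T(a)`. -/
def IsAncestor {n : ℕ} (par : Fin n → Option (Fin n)) (a z : Option (Fin n)) : Prop :=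
  ∃ j : ℕ, (up par)^[j] z = a

/-- The distance of a vertex from the pseudo root. -/
noncomputable def depth {n : ℕ} (par : Fin n → Option (Fin n)) (z : Option (Fin n)) : ℕ :=
  sInf {j : ℕ | (up par)^[j] z = none}

/-- `w` is the lowest common ancestor of `x` and `y`. -/
def IsLCA {n : ℕ} (par : Fin n → Option (Fin n)) (w x y : Option (Fin n)) : Prop :=
  IsAncestor par w x ∧ IsAncestor par w y ∧
    ∀ a, IsAncestor par a x → IsAncestor par a y → IsAncestor par a w

/-- The number of vertices of the subtree `T(v)`. -/
noncomputable def subtreeSize {n : ℕ} (par : Fin n → Option (Fin n)) (v : Fin n) : ℕ :=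
  {z : Fin n | IsAncestor par (some v) (some z)}.ncard

/-- The edge `e` is a cross edge: its lowest common ancestor is neither of its endpoints. -/
def IsCrossEdge {n : ℕ} (par : Fin n → Option (Fin n)) (e : Sym2 (Fin n)) : Prop :=
  ∃ (x y : Fin n) (w : Option (Fin n)),
    e = s(x, y) ∧ IsLCA par w (some x) (some y) ∧ w ≠ some x ∧ w ≠ some y

/-- `z` lies on the tree path from `v` down to its descendant `y`. -/
def OnPath {n : ℕ} (par : Fin n → Option (Fin n)) (v y z : Fin n) : Prop :=
  IsAncestor par (some v) (some z) ∧ IsAncestor par (some z) (some y)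

/-- `par'` arises from `par` by rebuilding `T(v)` so that it hangs from the edge `(x, y)`, where
`y` is a vertex of `T(v)`: the path from `v` to `y` is reversed, `y` becomes a child of `x`, and
all other parents are kept. -/
def IsReroot {n : ℕ} (par : Fin n → Option (Fin n)) (v x y : Fin n)
    (par' : Fin n → Option (Fin n)) : Prop :=
  par' y = some x ∧
  (∀ a b : Fin n, OnPath par v y b → b ≠ v → par b = some a → par' a = some b) ∧
  (∀ z : Fin n, ¬ OnPath par v y z → par' z = par z)

/-- The state of the algorithm: the tree, the edges of the current graph, the edges that wait to be
processed (the edge just inserted and the collected cross edges), and the edges that are still to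
be inserted by the user, in this order. -/
structure State (n : ℕ) where
  tree : Fin n → Option (Fin n)
  graph : Finset (Sym2 (Fin n))
  pending : Finset (Sym2 (Fin n))
  input : List (Sym2 (Fin n))

/-- Initially the graph has no edges apart from those at the pseudo root. -/
def initial {n : ℕ} (l : List (Sym2 (Fin n))) : State n where
  tree := fun _ => none
  graph := ∅
  pending := ∅
  input := l

open Classical in
/-- The edges of the graph `G` that are cross edges with respect to the tree `par`. -/
noncomputable def crossEdges {n : ℕ} (par : Fin n → Option (Fin n)) (G : Finset (Sym2 (Fin n))) :
    Finset (Sym2 (Fin n)) :=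
  G.filter (fun e => IsCrossEdge par e)

/-- `Step σ t τ`: ADFS1 can pass from `σ` to `τ` by one step, at the cost of `t` operations. Which
of the pending edges is processed next is arbitrary.

* `insert`: when no edge is pending, the next edge of the input arrives; cost `1`.
* `back`: a pending edge that is not a cross edge is put into the graph; cost `1`.
* `cross`: a pending cross edge `(x, y)`, with `x` at least as low in the tree as `y`, is put into
  the graph. With `w` the lowest common ancestor of `x` and `y`, and `v` the child of `w` whose
  subtree contains `y`, the subtree `T(v)` is rebuilt, hanging from `(x, y)`. The edges of the
  graph that this turns into cross edges are taken out and become pending. The cost is `1` for the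
  edge, `1` for every vertex of `T(v)` (all of these get new ancestors), and `1` for every
  collected edge. -/
inductive Step {n : ℕ} : State n → ℕ → State n → Prop
  | insert (par : Fin n → Option (Fin n)) (G : Finset (Sym2 (Fin n)))
      (e : Sym2 (Fin n)) (l : List (Sym2 (Fin n))) :
      Step ⟨par, G, ∅, e :: l⟩ 1 ⟨par, G, {e}, l⟩
  | back (par : Fin n → Option (Fin n)) (G P : Finset (Sym2 (Fin n)))
      (l : List (Sym2 (Fin n))) (e : Sym2 (Fin n))
      (he : e ∈ P) (hb : ¬ IsCrossEdge par e) :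
      Step ⟨par, G, P, l⟩ 1 ⟨par, insert e G, P.erase e, l⟩
  | cross (par par' : Fin n → Option (Fin n)) (G P : Finset (Sym2 (Fin n)))
      (l : List (Sym2 (Fin n))) (x y v : Fin n) (w : Option (Fin n))
      (he : s(x, y) ∈ P)
      (hw : IsLCA par w (some x) (some y)) (hx : w ≠ some x) (hy : w ≠ some y)
      (hlow : depth par (some y) ≤ depth par (some x))
      (hv : par v = w) (hvy : IsAncestor par (some v) (some y))
      (hr : IsReroot par v x y par') :
      Step ⟨par, G, P, l⟩
        (1 + subtreeSize par v + (crossEdges par' G).card)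
        ⟨par', insert s(x, y) (G \ crossEdges par' G),
          P.erase s(x, y) ∪ crossEdges par' G, l⟩

/-- `Execution l t σ`: on the insertion sequence `l` there is a (possibly unfinished) execution of
ADFS1 that reaches the state `σ` and costs `t` operations. -/
inductive Execution {n : ℕ} (l : List (Sym2 (Fin n))) : ℕ → State n → Prop
  | start : Execution l 0 (initial l)
  | step {t u : ℕ} {σ τ : State n} (h : Execution l t σ) (hs : Step σ u τ) :
      Execution l (t + u) τ

/-- All edges have been inserted and processed. -/
def State.Finished {n : ℕ} (σ : State n) : Prop :=
  σ.pending = ∅ ∧ σ.input = []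

/-- A sequence of `m` edge insertions into the empty graph on `n` vertices: `m` distinct edges
without loops. -/
def IsInsertionSequence (n m : ℕ) (l : List (Sym2 (Fin n))) : Prop :=
  l.length = m ∧ l.Nodup ∧ ∀ e ∈ l, ¬ e.IsDiag

end ADFS

/-! Upper bound. Since `x` is at least as deep as `y`, a rebuild moves every vertex of `T(v)`
strictly deeper, and no other vertex changes its depth. Depths never exceed `n`, so the rebuilt
subtrees have total size at most `n²`. A collected edge joins a vertex `a` of the reversed path to a
vertex of `T(v)`. Fix a threshold `F`. If `a` is among the lowest `F` path vertices, the edge is one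
of at most `F * |T(v)|` pairs. Otherwise `a` sinks by more than `F`, and the collected edges at `a`
are paid for by the sum of degree times depth, which never exceeds `2mn`. Together, `F` times the
number of collected edges is at most `2mn + F²n²`; the choice `F ≈ √(m/n)` gives `n^(3/2) m^(1/2)`.
The accounting is in `IsReroot.weightedDepth_add_le` and `Execution.exists_ledger`.

Lower bound. A chain of light vertices `c r, c (r+1), ..., c Q` has `K` rows (paths) of lengths `K,
K+1, ..., 2K-1` hanging from `c r`, and one extra row of length `2K`. The row vertices of the first
`K` rows are adjacent to all light vertices. The hub `c (r+1)`, with the chain below it, is first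
moved to the end of row `0`. Then an edge from the end of row `i+1` to the hub is processed: row `i`
is reversed and now hangs from the hub, beside the chain, so its edges to the light vertices below
the hub become cross edges. This collects at least `K(Q-R)` edges. After `K` such turns the hub sits
at the end of the extra row and all `K` rows hang from it, so the next phase can start with `c
(r+1)` in place of `c r` and a new extra row. A phase uses up only `2K` vertices and one light
vertex. With `Q` and `R*K` of order `n` and `K` of order `√(m/n)`, the `R` phases collect about `R
K² Q ≈ n² K` edges. One phase is `Layout.Situation.phase`, its main step
`Layout.Situation.next_turn`.

All edges are inserted beforehand, as back edges of a tree in which the light chain is upside down;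
one last insertion turns it over (`exists_situation`). From then on, all cross edges are pending and
can be processed in any convenient order. -/

namespace ADFS

/-! ### Rooted trees given by parent functions -/

variable {n : ℕ} {par par' : Fin n → Option (Fin n)}

/-- Every vertex reaches the pseudo root along parents. -/
def IsTree (par : Fin n → Option (Fin n)) : Prop :=
  ∀ z : Option (Fin n), ∃ j : ℕ, (up par)^[j] z = none

theorem IsAncestor.refl (z : Option (Fin n)) : IsAncestor par z z := ⟨0, rfl⟩

theorem IsAncestor.trans {a b c : Option (Fin n)} (h₁ : IsAncestor par a b)
    (h₂ : IsAncestor par b c) : IsAncestor par a c := by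
  obtain ⟨i, rfl⟩ := h₁
  obtain ⟨j, rfl⟩ := h₂
  exact ⟨i + j, Function.iterate_add_apply _ _ _ _⟩

theorem isAncestor_some_iff {a : Option (Fin n)} {z : Fin n} :
    IsAncestor par a (some z) ↔ a = some z ∨ IsAncestor par a (par z) := by
  constructor
  · rintro ⟨j, hj⟩
    cases j with
    | zero => exact Or.inl hj.symm
    | succ j => exact Or.inr ⟨j, by simpa [Function.iterate_succ_apply, up] using hj⟩
  · rintro (rfl | ⟨j, hj⟩)
    · exact .refl _
    · exact ⟨j + 1, by simpa [Function.iterate_succ_apply, up] using hj⟩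

theorem isAncestor_parent (z : Fin n) : IsAncestor par (par z) (some z) :=
  isAncestor_some_iff.2 (Or.inr (.refl _))

theorem isAncestor_none_iff {a : Option (Fin n)} : IsAncestor par a none ↔ a = none := by
  constructor
  · rintro ⟨j, hj⟩
    rw [← hj]
    exact Function.iterate_fixed (f := up par) rfl j
  · rintro rfl
    exact .refl _

theorem depth_none : depth par none = 0 :=
  Nat.sInf_eq_zero.2 (Or.inl rfl)

theorem isAncestor_of_path {p : ℕ → Fin n} {L : ℕ}
    (hp : ∀ k < L, par (p (k + 1)) = some (p k)) {i j : ℕ} (hij : i ≤ j) (hj : j ≤ L) :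
    IsAncestor par (some (p i)) (some (p j)) := by
  induction j, hij using Nat.le_induction with
  | base => exact .refl _
  | succ j hij ih =>
    exact isAncestor_some_iff.2 (Or.inr (by rw [hp j hj]; exact ih (by omega)))

/-- The ancestors of a vertex of a path that hangs from `w`. -/
theorem isAncestor_path_iff {p : ℕ → Fin n} {L : ℕ} {w a : Option (Fin n)}
    (h0 : par (p 0) = w) (hp : ∀ k < L, par (p (k + 1)) = some (p k)) {j : ℕ} (hj : j ≤ L) :
    IsAncestor par a (some (p j)) ↔ (∃ i ≤ j, a = some (p i)) ∨ IsAncestor par a w := by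
  induction j with
  | zero => rw [isAncestor_some_iff, h0]; simp
  | succ j ih =>
    rw [isAncestor_some_iff, hp j hj, ih (by omega)]
    constructor
    · rintro (h | ⟨i, hi, h⟩ | h)
      · exact Or.inl ⟨j + 1, le_rfl, h⟩
      · exact Or.inl ⟨i, by omega, h⟩
      · exact Or.inr h
    · rintro (⟨i, hi, h⟩ | h)
      · rcases hi.lt_or_eq with hi | rfl
        · exact Or.inr (Or.inl ⟨i, by omega, h⟩)
        · exact Or.inl h
      · exact Or.inr (Or.inr h)

namespace IsTree

theorem induction (hT : IsTree par) {P : Option (Fin n) → Prop} (h0 : P none)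
    (hs : ∀ z : Fin n, P (par z) → P (some z)) (z : Option (Fin n)) : P z := by
  obtain ⟨j, hj⟩ := hT z
  induction j generalizing z with
  | zero =>
    obtain rfl : z = none := hj
    exact h0
  | succ j ih =>
    cases z with
    | none => exact h0
    | some z => exact hs z (ih _ (by simpa [Function.iterate_succ_apply, up] using hj))

theorem isAncestor_none (hT : IsTree par) (z : Option (Fin n)) : IsAncestor par none z := hT z

theorem depth_some (hT : IsTree par) (z : Fin n) :
    depth par (some z) = depth par (par z) + 1 := by
  have h := Nat.sInf_add (p := fun j => (up par)^[j] (some z) = none) (n := 1) ?_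
  · rw [depth, ← h]
    simp [Function.iterate_succ_apply, up, depth]
  · refine le_csInf (hT (some z)) ?_
    rintro (_ | j) hj
    · simp at hj
    · omega

theorem depth_le (hT : IsTree par) {a z : Option (Fin n)} (h : IsAncestor par a z) :
    depth par a ≤ depth par z := by
  induction z using hT.induction with
  | h0 => rw [isAncestor_none_iff.1 h]
  | hs z ih =>
    rcases isAncestor_some_iff.1 h with rfl | h
    · exact le_rfl
    · have := ih h
      rw [hT.depth_some]
      omega

theorem eq_of_depth_le (hT : IsTree par) {a z : Option (Fin n)} (h : IsAncestor par a z)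
    (hd : depth par z ≤ depth par a) : a = z := by
  cases z with
  | none => exact isAncestor_none_iff.1 h
  | some z =>
    rcases isAncestor_some_iff.1 h with rfl | h
    · rfl
    · have := hT.depth_le h
      rw [hT.depth_some] at hd
      omega

theorem antisymm (hT : IsTree par) {a b : Option (Fin n)} (h₁ : IsAncestor par a b)
    (h₂ : IsAncestor par b a) : a = b :=
  hT.eq_of_depth_le h₁ (hT.depth_le h₂)

theorem not_isAncestor_parent (hT : IsTree par) (v : Fin n) :
    ¬ IsAncestor par (some v) (par v) := by
  intro h
  have := hT.depth_le h
  rw [hT.depth_some] at this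
  omega

theorem comparable (hT : IsTree par) {a b z : Option (Fin n)} (ha : IsAncestor par a z)
    (hb : IsAncestor par b z) : IsAncestor par a b ∨ IsAncestor par b a := by
  induction z using hT.induction with
  | h0 =>
    rw [isAncestor_none_iff.1 ha]
    exact Or.inl (hT.isAncestor_none _)
  | hs z ih =>
    rcases isAncestor_some_iff.1 ha with rfl | ha'
    · exact Or.inr hb
    · rcases isAncestor_some_iff.1 hb with rfl | hb'
      · exact Or.inl ha
      · exact ih ha' hb'

theorem isAncestor_of_depth_le (hT : IsTree par) {a b z : Option (Fin n)}
    (ha : IsAncestor par a z) (hb : IsAncestor par b z) (hd : depth par a ≤ depth par b) :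
    IsAncestor par a b := by
  rcases hT.comparable ha hb with h | h
  · exact h
  · rw [hT.eq_of_depth_le h hd]
    exact .refl _

theorem exists_isLCA (hT : IsTree par) (z y : Option (Fin n)) : ∃ w, IsLCA par w z y := by
  induction z using hT.induction with
  | h0 => exact ⟨none, .refl _, hT.isAncestor_none _, fun a h _ => h⟩
  | hs z ih =>
    by_cases h : IsAncestor par (some z) y
    · exact ⟨some z, .refl _, h, fun a h _ => h⟩
    · obtain ⟨w, h1, h2, h3⟩ := ih
      refine ⟨w, h1.trans (isAncestor_parent z), h2, fun a ha hay => ?_⟩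
      rcases isAncestor_some_iff.1 ha with rfl | ha
      · exact absurd hay h
      · exact h3 a ha hay

theorem isLCA_unique (hT : IsTree par) {w w' x y : Option (Fin n)} (h : IsLCA par w x y)
    (h' : IsLCA par w' x y) : w = w' :=
  hT.antisymm (h'.2.2 _ h.1 h.2.1) (h.2.2 _ h'.1 h'.2.1)

theorem isCrossEdge_iff (hT : IsTree par) {x y : Fin n} :
    IsCrossEdge par s(x, y) ↔
      ¬ IsAncestor par (some x) (some y) ∧ ¬ IsAncestor par (some y) (some x) := by
  constructor
  · rintro ⟨a, b, w, he, ⟨h1, h2, h3⟩, hx, hy⟩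
    have key : ¬ IsAncestor par (some a) (some b) ∧ ¬ IsAncestor par (some b) (some a) :=
      ⟨fun h => hx (hT.antisymm h1 (h3 _ (.refl _) h)),
        fun h => hy (hT.antisymm h2 (h3 _ h (.refl _)))⟩
    rcases Sym2.eq_iff.1 he with ⟨rfl, rfl⟩ | ⟨rfl, rfl⟩
    · exact key
    · exact key.symm
  · rintro ⟨h1, h2⟩
    obtain ⟨w, hw⟩ := hT.exists_isLCA (some x) (some y)
    refine ⟨x, y, w, rfl, hw, ?_, ?_⟩
    · rintro rfl; exact h1 hw.2.1
    · rintro rfl; exact h2 hw.1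

theorem exists_child (hT : IsTree par) {w y : Option (Fin n)} (h : IsAncestor par w y)
    (hne : w ≠ y) : ∃ v : Fin n, par v = w ∧ IsAncestor par (some v) y := by
  induction y using hT.induction with
  | h0 => exact absurd (isAncestor_none_iff.1 h) hne
  | hs z ih =>
    rcases isAncestor_some_iff.1 h with h | h
    · exact absurd h hne
    · by_cases hz : w = par z
      · exact ⟨z, hz.symm, .refl _⟩
      · obtain ⟨v, h1, h2⟩ := ih h hz
        exact ⟨v, h1, h2.trans (isAncestor_parent z)⟩

theorem depth_eq_card (hT : IsTree par) (z : Option (Fin n)) :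
    depth par z = {a : Fin n | IsAncestor par (some a) z}.ncard := by
  induction z using hT.induction with
  | h0 => simp [depth_none, isAncestor_none_iff]
  | hs z ih =>
    have : {a : Fin n | IsAncestor par (some a) (some z)} =
        insert z {a : Fin n | IsAncestor par (some a) (par z)} := by
      ext a
      simp [isAncestor_some_iff]
    rw [hT.depth_some, ih, this, Set.ncard_insert_of_notMem _ (Set.toFinite _)]
    exact hT.not_isAncestor_parent z

theorem depth_le_card (hT : IsTree par) (z : Option (Fin n)) : depth par z ≤ n := by
  rw [hT.depth_eq_card]
  simpa using Set.ncard_le_card {a : Fin n | IsAncestor par (some a) z}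

theorem depth_path (hT : IsTree par) {p : ℕ → Fin n} {L : ℕ} {w : Option (Fin n)}
    (h0 : par (p 0) = w) (hp : ∀ k < L, par (p (k + 1)) = some (p k)) {j : ℕ} (hj : j ≤ L) :
    depth par (some (p j)) = depth par w + j + 1 := by
  induction j with
  | zero => rw [hT.depth_some, h0]
  | succ j ih =>
    rw [hT.depth_some, hp j hj, ih (by omega)]
    omega

/-- The lowest common ancestor of `x` and a vertex `y` below a child `v` of an ancestor of `x`. -/
theorem isLCA_of_child (hT : IsTree par) {x y v : Fin n}
    (hvx : ¬ IsAncestor par (some v) (some x)) (hvy : IsAncestor par (some v) (some y))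
    (hx : IsAncestor par (par v) (some x)) : IsLCA par (par v) (some x) (some y) := by
  refine ⟨hx, (isAncestor_parent v).trans hvy, fun a hax hay => ?_⟩
  rcases hT.comparable hay hvy with h | h
  · rcases isAncestor_some_iff.1 h with rfl | h
    · exact absurd hax hvx
    · exact h
  · exact absurd (h.trans hax) hvx

end IsTree

/-- A height that drops along parents excludes cycles. Together with `IsTree.depth_eq`, one explicit
function certifies both that a rebuilt parent function is a tree and what its depths are. -/
theorem isTree_of_height {d : Option (Fin n) → ℕ} (hd : ∀ z : Fin n, d (par z) < d (some z)) :
    IsTree par := by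
  intro z
  induction hk : d z using Nat.strong_induction_on generalizing z with
  | _ k ih =>
    cases z with
    | none => exact ⟨0, rfl⟩
    | some z =>
      obtain ⟨j, hj⟩ := ih (d (par z)) (by rw [← hk]; exact hd z) _ rfl
      exact ⟨j + 1, by simpa [Function.iterate_succ_apply, up] using hj⟩

theorem IsTree.depth_eq {d : Option (Fin n) → ℕ} (hT : IsTree par) (h0 : d none = 0)
    (hd : ∀ z : Fin n, d (some z) = d (par z) + 1) (z : Option (Fin n)) : depth par z = d z := by
  induction z using hT.induction with
  | h0 => rw [depth_none, h0]
  | hs z ih => rw [hT.depth_some, hd, ih]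

end ADFS

/-! ### Rerooting a subtree: new depths and new ancestors -/

namespace ADFS

variable {n : ℕ} {par par' : Fin n → Option (Fin n)}

theorem IsAncestor.parent_of_ne {v z : Fin n} (h : IsAncestor par (some v) (some z))
    (hne : z ≠ v) : IsAncestor par (some v) (par z) := by
  rcases isAncestor_some_iff.1 h with h | h
  · exact absurd (Option.some_injective _ h).symm hne
  · exact h

theorem IsTree.eq_of_parent_eq (hT : IsTree par) {a : Option (Fin n)} {b b' y : Fin n}
    (hb : par b = a) (hb' : par b' = a) (h : IsAncestor par (some b) (some y))
    (h' : IsAncestor par (some b') (some y)) : b = b' := by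
  have hd : depth par (some b) = depth par (some b') := by
    rw [hT.depth_some, hT.depth_some, hb, hb']
  exact Option.some_injective _
    (hT.eq_of_depth_le (hT.isAncestor_of_depth_le h h' hd.le) hd.ge)

/-- A path vertex other than the lower end has a child on the path. -/
theorem IsTree.exists_onPath_child (hT : IsTree par) {v y a : Fin n} (ha : OnPath par v y a)
    (hne : a ≠ y) : ∃ b, OnPath par v y b ∧ b ≠ v ∧ par b = some a := by
  obtain ⟨b, h1, h2⟩ := hT.exists_child ha.2 (by simpa using hne)
  refine ⟨b, ⟨ha.1.trans (h1 ▸ isAncestor_parent b), h2⟩, ?_, h1⟩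
  rintro rfl
  exact hT.not_isAncestor_parent b (h1 ▸ ha.1)

theorem IsTree.exists_isReroot (hT : IsTree par) {v y : Fin n} (x : Fin n)
    (hvy : IsAncestor par (some v) (some y)) : ∃ par', IsReroot par v x y par' := by
  classical
  refine ⟨fun z => if h : OnPath par v y z then
    if h' : z = y then some x else some (hT.exists_onPath_child h h').choose else par z,
    ?_, ?_, ?_⟩
  · simp [show OnPath par v y y from ⟨hvy, .refl _⟩]
  · intro a b hb hbv hab
    have ha : OnPath par v y a :=
      ⟨hab ▸ hb.1.parent_of_ne hbv, isAncestor_some_iff.2 (Or.inr (hab ▸ .refl _)) |>.trans hb.2⟩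
    have hay : a ≠ y := by
      rintro rfl
      exact hT.not_isAncestor_parent b (hab ▸ hb.2)
    have hs := (hT.exists_onPath_child ha hay).choose_spec
    simp only [ha, hay, dif_pos, dif_neg, not_false_eq_true]
    exact congrArg some (hT.eq_of_parent_eq hs.2.2 hab hs.1.2 hb.2)
  · intro z hz
    simp [hz]

namespace IsReroot

variable {v x y : Fin n}

theorem parent_of_not_isAncestor (hr : IsReroot par v x y par') {z : Fin n}
    (hz : ¬ IsAncestor par (some v) (some z)) : par' z = par z :=
  hr.2.2 z fun h => hz h.1

/-- The new way from the pseudo root to a vertex `z` of `T(v)` runs through `x` and `y`, up to `w =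
LCA(z, y)`, and down to `z`. Its length is `depth x + 1 + (depth y - depth w) + (depth z - depth
w)`, stated here without subtraction. -/
theorem exists_height (hr : IsReroot par v x y par') (hT : IsTree par)
    (hvx : ¬ IsAncestor par (some v) (some x)) (hvy : IsAncestor par (some v) (some y)) :
    ∃ d : Option (Fin n) → ℕ, d none = 0 ∧ (∀ z : Fin n, d (some z) = d (par' z) + 1) ∧
      (∀ z, ¬ IsAncestor par (some v) z → d z = depth par z) ∧
      ∀ z w, IsAncestor par (some v) z → IsLCA par w z (some y) →
        d z + 2 * depth par w = depth par (some x) + 1 + depth par (some y) + depth par z := by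
  classical
  choose f hf using fun z => hT.exists_isLCA z (some y)
  let d : Option (Fin n) → ℕ := fun z => if IsAncestor par (some v) z then
    depth par (some x) + 1 + depth par (some y) + depth par z - 2 * depth par (f z)
    else depth par z
  have hd1 : ∀ z, ¬ IsAncestor par (some v) z → d z = depth par z := fun z hz => by simp [d, hz]
  have hd2 : ∀ z w, IsAncestor par (some v) z → IsLCA par w z (some y) →
      d z + 2 * depth par w = depth par (some x) + 1 + depth par (some y) + depth par z := by
    intro z w hz hw
    have e := hT.isLCA_unique hw (hf z)
    have h1 := hT.depth_le hw.1
    have h2 := hT.depth_le hw.2.1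
    simp only [d, hz, if_true, ← e]
    omega
  have hself : ∀ z : Fin n, IsAncestor par (some z) (some y) →
      IsLCA par (some z) (some z) (some y) := fun z hz => ⟨.refl _, hz, fun _ h _ => h⟩
  refine ⟨d, ?_, ?_, hd1, hd2⟩
  · rw [hd1 _ (by simp [isAncestor_none_iff]), depth_none]
  · intro z
    by_cases hz : IsAncestor par (some v) (some z)
    · by_cases hzy : IsAncestor par (some z) (some y)
      · have e1 := hd2 _ _ hz (hself z hzy)
        have e0 := hT.depth_le hzy
        by_cases hne : z = y
        · subst hne
          rw [hr.1, hd1 _ hvx]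
          omega
        · obtain ⟨b, hb, hbv, hbz⟩ := hT.exists_onPath_child ⟨hz, hzy⟩ hne
          rw [hr.2.1 z b hb hbv hbz]
          have e2 := hd2 _ _ hb.1 (hself b hb.2)
          have e3 := hT.depth_some b
          have e4 := hT.depth_le hb.2
          rw [hbz] at e3
          omega
      · have hzv : z ≠ v := by rintro rfl; exact hzy hvy
        have hw := hf (par z)
        have hw' : IsLCA par (f (par z)) (some z) (some y) := by
          refine ⟨hw.1.trans (isAncestor_parent z), hw.2.1, fun a ha hay => ?_⟩
          rcases isAncestor_some_iff.1 ha with rfl | ha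
          · exact absurd hay hzy
          · exact hw.2.2 a ha hay
        have e1 := hd2 _ _ hz hw'
        have e2 := hd2 _ _ (hz.parent_of_ne hzv) hw
        have e3 := hT.depth_some z
        rw [hr.2.2 z fun h => hzy h.2]
        omega
    · rw [hr.parent_of_not_isAncestor hz, hd1 _ hz, hd1, hT.depth_some]
      exact fun h => hz (h.trans (isAncestor_parent z))

theorem isTree (hr : IsReroot par v x y par') (hT : IsTree par)
    (hvx : ¬ IsAncestor par (some v) (some x)) (hvy : IsAncestor par (some v) (some y)) :
    IsTree par' := by
  obtain ⟨d, -, h, -⟩ := hr.exists_height hT hvx hvy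
  exact isTree_of_height (d := d) fun z => by rw [h]; omega

theorem depth_of_not_isAncestor (hr : IsReroot par v x y par') (hT : IsTree par)
    (hvx : ¬ IsAncestor par (some v) (some x)) (hvy : IsAncestor par (some v) (some y))
    {z : Option (Fin n)} (hz : ¬ IsAncestor par (some v) z) : depth par' z = depth par z := by
  obtain ⟨d, h0, hs, h1, -⟩ := hr.exists_height hT hvx hvy
  rw [(hr.isTree hT hvx hvy).depth_eq h0 hs, h1 z hz]

theorem depth_of_isAncestor (hr : IsReroot par v x y par') (hT : IsTree par)
    (hvx : ¬ IsAncestor par (some v) (some x)) (hvy : IsAncestor par (some v) (some y))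
    {z w : Option (Fin n)} (hz : IsAncestor par (some v) z) (hw : IsLCA par w z (some y)) :
    depth par' z + 2 * depth par w =
      depth par (some x) + 1 + depth par (some y) + depth par z := by
  obtain ⟨d, h0, hs, -, h1⟩ := hr.exists_height hT hvx hvy
  rw [(hr.isTree hT hvx hvy).depth_eq h0 hs, h1 z w hz hw]

/-- The gain is `depth x + 1 + depth y - 2 * depth w`, where `w` is an ancestor of `y` and `x` is at
least as deep as `y`. This is where the rule for choosing `x` enters. -/
theorem depth_lt (hr : IsReroot par v x y par') (hT : IsTree par)
    (hvx : ¬ IsAncestor par (some v) (some x)) (hvy : IsAncestor par (some v) (some y))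
    (hlow : depth par (some y) ≤ depth par (some x))
    {z : Option (Fin n)} (hz : IsAncestor par (some v) z) : depth par z < depth par' z := by
  obtain ⟨w, hw⟩ := hT.exists_isLCA z (some y)
  have h1 := hr.depth_of_isAncestor hT hvx hvy hz hw
  have h2 := hT.depth_le hw.2.1
  omega

theorem depth_le (hr : IsReroot par v x y par') (hT : IsTree par)
    (hvx : ¬ IsAncestor par (some v) (some x)) (hvy : IsAncestor par (some v) (some y))
    (hlow : depth par (some y) ≤ depth par (some x)) (z : Option (Fin n)) :
    depth par z ≤ depth par' z := by
  by_cases hz : IsAncestor par (some v) z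
  · exact (hr.depth_lt hT hvx hvy hlow hz).le
  · exact (hr.depth_of_not_isAncestor hT hvx hvy hz).ge

theorem depth_onPath (hr : IsReroot par v x y par') (hT : IsTree par)
    (hvx : ¬ IsAncestor par (some v) (some x)) (hvy : IsAncestor par (some v) (some y))
    {a : Fin n} (ha : OnPath par v y a) :
    depth par' (some a) + depth par (some a) = depth par (some x) + 1 + depth par (some y) := by
  have := hr.depth_of_isAncestor hT hvx hvy ha.1 ⟨.refl _, ha.2, fun _ h _ => h⟩
  omega

theorem isAncestor_of_not_isAncestor (hr : IsReroot par v x y par') (hT : IsTree par)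
    {a z : Option (Fin n)} (hz : ¬ IsAncestor par (some v) z) (ha : IsAncestor par a z) :
    IsAncestor par' a z := by
  induction z using hT.induction with
  | h0 => rw [isAncestor_none_iff.1 ha]; exact .refl _
  | hs z ih =>
    rcases isAncestor_some_iff.1 ha with rfl | ha
    · exact .refl _
    · refine isAncestor_some_iff.2 (Or.inr ?_)
      rw [hr.parent_of_not_isAncestor hz]
      exact ih (fun h => hz (h.trans (isAncestor_parent z))) ha

/-- If `a` is not above `y`, then no vertex on the way from `z` up to `a` is above `y` either, so
the way avoids the reversed path and keeps all its parents. -/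
theorem isAncestor_of_off_path (hr : IsReroot par v x y par') (hT : IsTree par)
    {a z : Option (Fin n)} (hay : ¬ IsAncestor par a (some y)) (ha : IsAncestor par a z) :
    IsAncestor par' a z := by
  induction z using hT.induction with
  | h0 => rw [isAncestor_none_iff.1 ha]; exact .refl _
  | hs z ih =>
    rcases isAncestor_some_iff.1 ha with rfl | ha'
    · exact .refl _
    · refine isAncestor_some_iff.2 (Or.inr ?_)
      rw [hr.2.2 z fun h => hay (ha.trans h.2)]
      exact ih ha'

/-- New parents of vertices of `T(v)` stay in `T(v)`, except that of `y`, which is `x`. -/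
theorem isAncestor_attach (hr : IsReroot par v x y par') (hT : IsTree par)
    (hvx : ¬ IsAncestor par (some v) (some x)) (hvy : IsAncestor par (some v) (some y))
    {z : Option (Fin n)} (hz : IsAncestor par (some v) z) : IsAncestor par' (some x) z := by
  induction z using (hr.isTree hT hvx hvy).induction with
  | h0 => simp [isAncestor_none_iff] at hz
  | hs z ih =>
    refine isAncestor_some_iff.2 (Or.inr ?_)
    by_cases hzy : z = y
    · rw [hzy, hr.1]; exact .refl _
    · refine ih ?_
      by_cases hp : OnPath par v y z
      · obtain ⟨b, hb, hbv, hbz⟩ := hT.exists_onPath_child hp hzy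
        rw [hr.2.1 z b hb hbv hbz]
        exact hb.1
      · rw [hr.2.2 z hp]
        refine hz.parent_of_ne ?_
        rintro rfl
        exact hp ⟨hz, hvy⟩

/-- A tree edge or back edge that a rebuild turns into a cross edge joins the reversed path to the
rebuilt subtree. -/
theorem onPath_of_not_isAncestor (hr : IsReroot par v x y par') (hT : IsTree par)
    (hvx : ¬ IsAncestor par (some v) (some x)) (hvy : IsAncestor par (some v) (some y))
    (hx : IsAncestor par (par v) (some x)) {a b : Fin n}
    (hab : IsAncestor par (some a) (some b)) (hab' : ¬ IsAncestor par' (some a) (some b)) :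
    OnPath par v y a ∧ IsAncestor par (some v) (some b) := by
  have hay : IsAncestor par (some a) (some y) := by
    by_contra h
    exact hab' (hr.isAncestor_of_off_path hT h hab)
  have hva : IsAncestor par (some v) (some a) := by
    by_contra hva
    rcases hT.comparable hay hvy with h | h
    -- Here `a` lies strictly above `v`, hence above `x`; the rebuilt subtree is hung below `x` and
    -- so stays below `a`.
    · by_cases hvb : IsAncestor par (some v) (some b)
      · have hav : IsAncestor par (some a) (par v) := by
          refine h.parent_of_ne ?_
          rintro rfl
          exact hva (.refl _)
        exact hab' ((hr.isAncestor_of_not_isAncestor hT hvx (hav.trans hx)).trans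
          (hr.isAncestor_attach hT hvx hvy hvb))
      · exact hab' (hr.isAncestor_of_not_isAncestor hT hvb hab)
    · exact hva h
  exact ⟨⟨hva, hay⟩, hva.trans hab⟩

/-- The new parents when the reversed path is given as a sequence. -/
theorem parent_path (hT : IsTree par) {p : ℕ → Fin n} {L : ℕ}
    (hp : ∀ k < L, par (p (k + 1)) = some (p k)) (hr : IsReroot par (p 0) x (p L) par') :
    par' (p L) = some x ∧ (∀ k < L, par' (p k) = some (p (k + 1))) ∧
      ∀ z, (∀ k ≤ L, z ≠ p k) → par' z = par z := by
  refine ⟨hr.1, fun k hk => hr.2.1 _ _ ⟨isAncestor_of_path hp (Nat.zero_le _) hk,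
    isAncestor_of_path hp hk le_rfl⟩ ?_ (hp k hk), fun z hz => hr.2.2 z ?_⟩
  · intro h
    have := hT.depth_path rfl hp (j := k + 1) hk
    rw [h, hT.depth_some] at this
    omega
  · rintro ⟨h1, h2⟩
    rcases (isAncestor_path_iff rfl hp le_rfl).1 h2 with ⟨i, hi, h⟩ | h
    · exact hz i hi (Option.some_injective _ h)
    · exact hT.not_isAncestor_parent _ (h1.trans h)

end IsReroot

end ADFS

/-! ### Invariants and progress of an execution -/

namespace ADFS

variable {n : ℕ}

/-- The invariants of the algorithm, relative to the set `E` of all edges of the input. -/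
structure State.Valid (E : Finset (Sym2 (Fin n))) (σ : State n) : Prop where
  isTree : IsTree σ.tree
  not_cross : ∀ e ∈ σ.graph, ¬ IsCrossEdge σ.tree e
  graph_subset : σ.graph ⊆ E
  pending_subset : σ.pending ⊆ E
  input_subset : ∀ e ∈ σ.input, e ∈ E

theorem mem_crossEdges {par : Fin n → Option (Fin n)} {G : Finset (Sym2 (Fin n))}
    {e : Sym2 (Fin n)} : e ∈ crossEdges par G ↔ e ∈ G ∧ IsCrossEdge par e := by
  simp [crossEdges]

theorem IsTree.initial : IsTree (fun _ : Fin n => (none : Option (Fin n))) := by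
  rintro (_ | z)
  · exact ⟨0, rfl⟩
  · exact ⟨1, rfl⟩

theorem valid_initial (l : List (Sym2 (Fin n))) : (initial l).Valid l.toFinset where
  isTree := IsTree.initial
  not_cross := by simp [initial]
  graph_subset := by simp [initial]
  pending_subset := by simp [initial]
  input_subset := by simp [initial]

theorem IsTree.not_isAncestor_of_isLCA {par : Fin n → Option (Fin n)} (hT : IsTree par)
    {x y v : Fin n} {w : Option (Fin n)} (hw : IsLCA par w (some x) (some y)) (hv : par v = w)
    (hvy : IsAncestor par (some v) (some y)) : ¬ IsAncestor par (some v) (some x) :=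
  fun h => hT.not_isAncestor_parent v (hv ▸ hw.2.2 _ h hvy)

theorem IsReroot.not_isCrossEdge {par par' : Fin n → Option (Fin n)} {v x y : Fin n}
    (hr : IsReroot par v x y par') (hT' : IsTree par') : ¬ IsCrossEdge par' s(x, y) := by
  rw [hT'.isCrossEdge_iff]
  intro h
  exact h.1 (isAncestor_some_iff.2 (Or.inr (by rw [hr.1]; exact .refl _)))

theorem State.Valid.step {E : Finset (Sym2 (Fin n))} {σ τ : State n} {u : ℕ}
    (h : σ.Valid E) (hs : Step σ u τ) : τ.Valid E := by
  obtain ⟨h1, h2, h3, h4, h5⟩ := h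
  cases hs with
  | insert par G e l =>
    simp only [List.mem_cons, forall_eq_or_imp] at h5
    exact ⟨h1, h2, h3, by simpa using h5.1, h5.2⟩
  | back par G P l e he hb =>
    refine ⟨h1, ?_, ?_, (Finset.erase_subset _ _).trans h4, h5⟩
    · intro e' he'
      rcases Finset.mem_insert.1 he' with rfl | he'
      · exact hb
      · exact h2 e' he'
    · exact Finset.insert_subset (h4 he) h3
  | cross par par' G P l x y v w he hw hx hy hlow hv hvy hr =>
    have hvx := h1.not_isAncestor_of_isLCA hw hv hvy
    have hT' := hr.isTree h1 hvx hvy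
    refine ⟨hT', ?_, ?_, ?_, h5⟩
    · intro e' he'
      rcases Finset.mem_insert.1 he' with rfl | he'
      · exact hr.not_isCrossEdge hT'
      · rw [Finset.mem_sdiff, mem_crossEdges] at he'
        exact fun hc => he'.2 ⟨he'.1, hc⟩
    · exact Finset.insert_subset (h4 he) (Finset.sdiff_subset.trans h3)
    · exact Finset.union_subset ((Finset.erase_subset _ _).trans h4)
        fun e he => h3 (mem_crossEdges.1 he).1

theorem Execution.valid {l : List (Sym2 (Fin n))} {t : ℕ} {σ : State n}
    (h : Execution l t σ) : σ.Valid l.toFinset := by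
  induction h with
  | start => exact valid_initial l
  | step h hs ih => exact ih.step hs

theorem Step.one_le {σ τ : State n} {u : ℕ} (hs : Step σ u τ) : 1 ≤ u := by
  cases hs <;> omega

/-- Each insertion costs one operation, so a finished execution costs at least `m`; this is all that
small `n` requires. -/
theorem Execution.length_le {l : List (Sym2 (Fin n))} {t : ℕ} {σ : State n}
    (h : Execution l t σ) : l.length ≤ t + σ.input.length := by
  induction h with
  | start => simp [initial]
  | step h hs ih =>
    cases hs with
    | insert par G e l => simp only [List.length_cons] at ih ⊢; omega
    | back => simp only at ih ⊢; omega
    | cross => simp only at ih ⊢; omega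

/-- As long as the execution is not finished, some step is possible. -/
theorem State.Valid.exists_step {E : Finset (Sym2 (Fin n))} {σ : State n} (h : σ.Valid E)
    (hf : ¬ σ.Finished) : ∃ u τ, Step σ u τ := by
  obtain ⟨par, G, P, l⟩ := σ
  have hT : IsTree par := h.isTree
  by_cases hP : P = ∅
  · subst hP
    cases l with
    | nil => exact absurd ⟨rfl, rfl⟩ hf
    | cons e l => exact ⟨_, _, .insert par G e l⟩
  · obtain ⟨e, he⟩ := Finset.nonempty_of_ne_empty hP
    by_cases hc : IsCrossEdge par e
    · obtain ⟨x, y, hxy, hlow, hc⟩ : ∃ x y : Fin n, e = s(x, y) ∧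
          depth par (some y) ≤ depth par (some x) ∧ IsCrossEdge par s(x, y) := by
        induction e with
        | h x y =>
          rcases le_total (depth par (some y)) (depth par (some x)) with h | h
          · exact ⟨x, y, rfl, h, hc⟩
          · exact ⟨y, x, Sym2.eq_swap, h, by rwa [Sym2.eq_swap]⟩
      subst hxy
      obtain ⟨h1, h2⟩ := hT.isCrossEdge_iff.1 hc
      obtain ⟨w, hw⟩ := hT.exists_isLCA (some x) (some y)
      have hx : w ≠ some x := by rintro rfl; exact h1 hw.2.1
      have hy : w ≠ some y := by rintro rfl; exact h2 hw.1
      obtain ⟨v, hv, hvy⟩ := hT.exists_child hw.2.1 hy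
      obtain ⟨par', hr⟩ := hT.exists_isReroot x hvy
      exact ⟨_, _, .cross par par' G P l x y v w he hw hx hy hlow hv hvy hr⟩
    · exact ⟨_, _, .back par G P l e he hc⟩

/-! ### The depth potentials and the upper bound -/

/-- The sum of the depths of all vertices. -/
noncomputable def totalDepth (par : Fin n → Option (Fin n)) : ℕ :=
  ∑ z : Fin n, depth par (some z)

/-- The number of edges of `E` at a vertex. -/
def edgeDegree (E : Finset (Sym2 (Fin n))) (z : Fin n) : ℕ :=
  (E.filter (fun e => z ∈ e)).card

/-- The sum of the depths of all vertices, weighted by their degrees. -/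
noncomputable def weightedDepth (E : Finset (Sym2 (Fin n))) (par : Fin n → Option (Fin n)) : ℕ :=
  ∑ z : Fin n, edgeDegree E z * depth par (some z)

theorem sum_edgeDegree_le (E : Finset (Sym2 (Fin n))) :
    ∑ z : Fin n, edgeDegree E z ≤ 2 * E.card := by
  have h := Finset.sum_card_bipartiteAbove_eq_sum_card_bipartiteBelow
    (s := (Finset.univ : Finset (Fin n))) (t := E) (fun z e => z ∈ e)
  have h' : ∑ z : Fin n, edgeDegree E z =
      ∑ e ∈ E, (Finset.univ.filter fun z : Fin n => z ∈ e).card := h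
  rw [h', mul_comm]
  refine Finset.sum_le_card_nsmul _ _ _ fun e _ => ?_
  induction e with
  | h x y =>
    refine (Finset.card_le_card (t := {x, y}) fun z hz => ?_).trans Finset.card_le_two
    simpa using hz

theorem IsTree.totalDepth_le {par : Fin n → Option (Fin n)} (hT : IsTree par) :
    totalDepth par ≤ n * n :=
  (Finset.sum_le_card_nsmul Finset.univ (fun z : Fin n => depth par (some z)) n
    fun z _ => hT.depth_le_card _).trans (by simp)

theorem IsTree.weightedDepth_le {par : Fin n → Option (Fin n)} (hT : IsTree par)
    (E : Finset (Sym2 (Fin n))) : weightedDepth E par ≤ 2 * E.card * n := by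
  calc weightedDepth E par ≤ ∑ z : Fin n, edgeDegree E z * n :=
        Finset.sum_le_sum fun z _ => Nat.mul_le_mul_left _ (hT.depth_le_card _)
    _ = (∑ z : Fin n, edgeDegree E z) * n := (Finset.sum_mul _ _ _).symm
    _ ≤ _ := Nat.mul_le_mul_right _ (sum_edgeDegree_le E)

theorem sum_add_sum_filter_le {f g h : Fin n → ℕ} {p : Fin n → Prop} [DecidablePred p]
    (h1 : ∀ z, f z ≤ h z) (h2 : ∀ z, p z → f z + g z ≤ h z) :
    ∑ z, f z + ∑ z with p z, g z ≤ ∑ z, h z := by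
  rw [Finset.sum_filter, ← Finset.sum_add_distrib]
  refine Finset.sum_le_sum fun z _ => ?_
  split_ifs with hz
  · exact h2 z hz
  · simpa using h1 z

section Reroot

variable {par par' : Fin n → Option (Fin n)} {v x y : Fin n}

theorem IsReroot.totalDepth_add_le (hr : IsReroot par v x y par') (hT : IsTree par)
    (hvx : ¬ IsAncestor par (some v) (some x)) (hvy : IsAncestor par (some v) (some y))
    (hlow : depth par (some y) ≤ depth par (some x)) :
    totalDepth par + subtreeSize par v ≤ totalDepth par' := by
  classical
  have hs : subtreeSize par v =
      ∑ z : Fin n with IsAncestor par (some v) (some z), 1 := by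
    rw [← Finset.card_eq_sum_ones, subtreeSize, ← Set.ncard_coe_finset]
    simp
  rw [hs]
  exact sum_add_sum_filter_le (fun z => hr.depth_le hT hvx hvy hlow _)
    fun z hz => hr.depth_lt hT hvx hvy hlow hz

/-- Collected edges at the lowest `F` vertices of the reversed path are paid for by the size of the
rebuilt subtree, the others by the increase of the weighted depth. -/
theorem IsReroot.weightedDepth_add_le (hr : IsReroot par v x y par') (hT : IsTree par)
    (hvx : ¬ IsAncestor par (some v) (some x)) (hvy : IsAncestor par (some v) (some y))
    (hx : IsAncestor par (par v) (some x))
    (hlow : depth par (some y) ≤ depth par (some x)) {E G : Finset (Sym2 (Fin n))}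
    (hG : ∀ e ∈ G, ¬ IsCrossEdge par e) (hGE : G ⊆ E) (F : ℕ) :
    weightedDepth E par + F * (crossEdges par' G).card ≤
      weightedDepth E par' + F * F * subtreeSize par v := by
  classical
  set N : Finset (Fin n) :=
    Finset.univ.filter fun a => OnPath par v y a ∧ depth par (some y) < depth par (some a) + F
  set T : Finset (Fin n) := Finset.univ.filter fun z => IsAncestor par (some v) (some z)
  set A : Finset (Fin n) :=
    Finset.univ.filter fun a => OnPath par v y a ∧ depth par (some a) + F ≤ depth par (some y)
    with hA
  have hTc : T.card = subtreeSize par v := by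
    rw [subtreeSize, ← Set.ncard_coe_finset]
    simp [T]
  -- The ancestors of `y` have distinct depths, so the distance to `y` maps `N` injectively into
  -- `{0, ..., F - 1}`.
  have hNc : N.card ≤ F := by
    have := Finset.card_le_card_of_injOn (s := N) (t := Finset.range F)
      (fun a => depth par (some y) - depth par (some a)) ?_ ?_
    · simpa using this
    · intro a ha
      have ha : OnPath par v y a ∧ depth par (some y) < depth par (some a) + F := by
        simpa [N] using ha
      have := hT.depth_le ha.1.2
      simp only [Finset.coe_range, Set.mem_Iio]
      omega
    · intro a ha b hb hab
      have ha : OnPath par v y a ∧ depth par (some y) < depth par (some a) + F := by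
        simpa [N] using ha
      have hb : OnPath par v y b ∧ depth par (some y) < depth par (some b) + F := by
        simpa [N] using hb
      have h1 := hT.depth_le ha.1.2
      have h2 := hT.depth_le hb.1.2
      have h3 : depth par (some a) = depth par (some b) := by
        simp only at hab
        omega
      exact Option.some_injective _ (hT.eq_of_depth_le
        (hT.isAncestor_of_depth_le ha.1.2 hb.1.2 h3.le) h3.ge)
  have hsub : crossEdges par' G ⊆ (N ×ˢ T).image (fun p => s(p.1, p.2)) ∪
      A.biUnion fun a => E.filter fun e => a ∈ e := by
    intro e he
    obtain ⟨heG, hc⟩ := mem_crossEdges.1 he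
    obtain ⟨a, b, rfl, hab⟩ : ∃ a b : Fin n, e = s(a, b) ∧ IsAncestor par (some a) (some b) := by
      induction e with
      | h a b =>
        have := hG _ heG
        rw [hT.isCrossEdge_iff, not_and_or, not_not, not_not] at this
        rcases this with h | h
        · exact ⟨a, b, rfl, h⟩
        · exact ⟨b, a, Sym2.eq_swap, h⟩
    obtain ⟨h1, h2⟩ := hr.onPath_of_not_isAncestor hT hvx hvy hx hab
      ((hr.isTree hT hvx hvy).isCrossEdge_iff.1 hc).1
    rw [Finset.mem_union]
    by_cases hd : depth par (some y) < depth par (some a) + F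
    · exact Or.inl (Finset.mem_image.2 ⟨(a, b), by simp [N, T, h1, h2, hd], rfl⟩)
    · exact Or.inr (Finset.mem_biUnion.2
        ⟨a, by simp [A, h1, not_lt.1 hd], by simp [hGE heG]⟩)
  have hcard : (crossEdges par' G).card ≤ F * subtreeSize par v + ∑ a ∈ A, edgeDegree E a := by
    refine (Finset.card_le_card hsub).trans ((Finset.card_union_le _ _).trans
      (add_le_add ?_ Finset.card_biUnion_le))
    refine Finset.card_image_le.trans ?_
    rw [Finset.card_product, hTc]
    exact Nat.mul_le_mul_right _ hNc
  have hfar : weightedDepth E par + ∑ a ∈ A, edgeDegree E a * F ≤ weightedDepth E par' := by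
    refine sum_add_sum_filter_le
      (fun z => Nat.mul_le_mul_left _ (hr.depth_le hT hvx hvy hlow _)) ?_
    rintro a ⟨h1, h2⟩
    rw [← mul_add]
    refine Nat.mul_le_mul_left _ ?_
    -- Reversal reflects depths on the path: `a` gains `depth x + 1 + depth y - 2 * depth a`, which
    -- is at least `2F + 1`.
    have := hr.depth_onPath hT hvx hvy h1
    omega
  rw [← Finset.sum_mul] at hfar
  have := Nat.mul_le_mul_left F hcard
  nlinarith

end Reroot

/-- The accounting of an execution: `c` edges have been collected and rebuilt subtrees of total
size `s` have been visited. -/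
theorem Execution.exists_ledger {l : List (Sym2 (Fin n))} {t : ℕ} {σ : State n}
    (h : Execution l t σ) (F : ℕ) : ∃ c s : ℕ,
      t + σ.pending.card + 2 * σ.input.length ≤ 2 * l.length + 2 * c + s ∧
      F * c ≤ weightedDepth l.toFinset σ.tree + F * F * s ∧ s ≤ totalDepth σ.tree := by
  induction h with
  | start => exact ⟨0, 0, by simp [initial], by simp, by simp⟩
  | @step t u σ τ h hs ih =>
    -- Credit two operations to each edge still in the input (arrival and processing) and one to
    -- each pending edge. A collected edge is charged at once and has to be processed again, hence
    -- the `2 * c`.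
    obtain ⟨c, s, h1, h2, h3⟩ := ih
    have hval := h.valid
    cases hs with
    | insert par G e l' =>
      refine ⟨c, s, ?_, h2, h3⟩
      simp only [Finset.card_empty, List.length_cons, Finset.card_singleton] at h1 ⊢
      omega
    | back par G P l' e he hb =>
      refine ⟨c, s, ?_, h2, h3⟩
      have := Finset.card_erase_add_one he
      simp only at h1 ⊢
      omega
    | cross par par' G P l' x y v w he hw hx hy hlow hv hvy hr =>
      have hT : IsTree par := hval.isTree
      have hvx := hT.not_isAncestor_of_isLCA hw hv hvy
      have e1 := hr.totalDepth_add_le hT hvx hvy hlow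
      have e2 := hr.weightedDepth_add_le hT hvx hvy (hv ▸ hw.1) hlow hval.not_cross
        hval.graph_subset F
      have e3 := Finset.card_erase_add_one he
      have e4 := Finset.card_union_le (P.erase s(x, y)) (crossEdges par' G)
      simp only at h1 h2 h3 e2 ⊢
      refine ⟨c + (crossEdges par' G).card, s + subtreeSize par v, by omega, ?_, by omega⟩
      rw [mul_add, mul_add]
      omega

/-- The number of collected edges is bounded only after multiplication by `F`. The threshold stays
free: `F = 1` already shows termination, and the optimal value is inserted in `Execution.cost_le`.
-/
theorem Execution.mul_le {l : List (Sym2 (Fin n))} {t : ℕ} {σ : State n}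
    (h : Execution l t σ) {F : ℕ} (hF : 1 ≤ F) :
    F * t ≤ 2 * F * l.length + 3 * (F * F) * (n * n) + 4 * l.length * n := by
  obtain ⟨c, s, h1, h2, h3⟩ := h.exists_ledger F
  have hT := h.valid.isTree
  have h4 := hT.totalDepth_le
  have h5 := hT.weightedDepth_le l.toFinset
  have h6 := l.toFinset_card_le
  have h7 : t ≤ 2 * l.length + 2 * c + s := by omega
  have h8 : 2 * l.toFinset.card * n ≤ 2 * l.length * n := by gcongr
  have h9 : s ≤ n * n := by omega
  have h10 : F * F * s ≤ F * F * (n * n) := Nat.mul_le_mul_left _ h9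
  have h11 : F * s ≤ F * F * (n * n) := by
    calc F * s ≤ F * (n * n) := Nat.mul_le_mul_left _ h9
      _ ≤ F * F * (n * n) := Nat.mul_le_mul_right _ (Nat.le_mul_of_pos_left _ hF)
  calc F * t ≤ F * (2 * l.length + 2 * c + s) := Nat.mul_le_mul_left _ h7
    _ = 2 * F * l.length + 2 * (F * c) + F * s := by ring
    _ ≤ _ := by linarith

/-- Every execution can be continued until all edges are inserted and processed. -/
theorem Execution.exists_finished {l : List (Sym2 (Fin n))} {t : ℕ} {σ : State n}
    (h : Execution l t σ) : ∃ t' τ, t ≤ t' ∧ Execution l t' τ ∧ τ.Finished := by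
  -- The cost is bounded in terms of `l` and `n` alone, and every step costs at least one; hence `B
  -- - t` decreases.
  obtain ⟨B, hB⟩ : ∃ B, ∀ t σ, Execution l t σ → t ≤ B :=
    ⟨_, fun t σ h => by simpa using h.mul_le le_rfl⟩
  induction hk : B - t using Nat.strong_induction_on generalizing t σ with
  | _ k ih =>
    by_cases hf : σ.Finished
    · exact ⟨t, σ, le_rfl, h, hf⟩
    · obtain ⟨u, τ, hs⟩ := h.valid.exists_step hf
      have h1 := hs.one_le
      have h2 := hB _ _ (h.step hs)
      obtain ⟨t', τ', h3, h4⟩ := ih _ (by omega) (h.step hs) rfl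
      exact ⟨t', τ', by omega, h4⟩

end ADFS

/-! ### Steering an execution: prescribed trees with all cross edges pending -/

namespace ADFS

variable {n : ℕ}

/-- Some execution that costs at least `t` operations inserts the edge set `E` (without loops) and
then reaches the tree `par`, where exactly the cross edges of `E` are pending. -/
def Reaches (E : Finset (Sym2 (Fin n))) (par : Fin n → Option (Fin n)) (t : ℕ) : Prop :=
  ∃ l : List (Sym2 (Fin n)), l.Nodup ∧ (∀ e ∈ l, ¬ e.IsDiag) ∧ l.toFinset = E ∧
    ∃ t', t ≤ t' ∧ Execution l t' ⟨par, E \ crossEdges par E, crossEdges par E, []⟩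

/-- Steps never look at the input beyond its head, so a sequence can be lengthened after the fact.
-/
theorem Execution.append {l : List (Sym2 (Fin n))} {t : ℕ} {σ : State n} (h : Execution l t σ)
    (l' : List (Sym2 (Fin n))) :
    Execution (l ++ l') t ⟨σ.tree, σ.graph, σ.pending, σ.input ++ l'⟩ := by
  induction h with
  | start => exact .start
  | step h hs ih =>
    refine ih.step ?_
    cases hs with
    | insert par G e l => exact .insert par G e _
    | back par G P l e he hb => exact .back par G P _ e he hb
    | cross par par' G P l x y v w he hw hx hy hlow hv hvy hr =>
      exact .cross par par' G P _ x y v w he hw hx hy hlow hv hvy hr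

/-- The pending edges that are not cross edges can be put into the graph. -/
theorem Execution.exists_saturated {l l' : List (Sym2 (Fin n))} {t : ℕ}
    {par : Fin n → Option (Fin n)} {G P E : Finset (Sym2 (Fin n))}
    (h : Execution l t ⟨par, G, P, l'⟩) (hE : G ∪ P = E) :
    ∃ t', t ≤ t' ∧ Execution l t' ⟨par, E \ crossEdges par E, crossEdges par E, l'⟩ := by
  induction hk : (P \ crossEdges par P).card using Nat.strong_induction_on generalizing t G P with
  | _ k ih =>
    have hG : ∀ e ∈ G, ¬ IsCrossEdge par e := h.valid.not_cross
    by_cases hP : P \ crossEdges par P = ∅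
    · have hP' : ∀ e ∈ P, IsCrossEdge par e := fun e he =>
        (mem_crossEdges.1 (Finset.sdiff_eq_empty_iff_subset.1 hP he)).2
      have h1 : crossEdges par E = P := by
        ext e
        rw [mem_crossEdges, ← hE, Finset.mem_union]
        constructor
        · rintro ⟨he | he, hc⟩
          · exact absurd hc (hG e he)
          · exact he
        · exact fun he => ⟨Or.inr he, hP' e he⟩
      have h2 : E \ P = G := by
        ext e
        rw [Finset.mem_sdiff, ← hE, Finset.mem_union]
        constructor
        · rintro ⟨he | he, hc⟩
          · exact he
          · exact absurd he hc
        · exact fun he => ⟨Or.inl he, fun he' => hG e he (hP' e he')⟩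
      exact ⟨t, le_rfl, by rwa [h1, h2]⟩
    · obtain ⟨e, he⟩ := Finset.nonempty_of_ne_empty hP
      rw [Finset.mem_sdiff, mem_crossEdges, not_and] at he
      have hlt : ((P.erase e) \ crossEdges par (P.erase e)).card < k := by
        rw [← hk]
        refine Finset.card_lt_card ((Finset.ssubset_iff_of_subset ?_).2 ⟨e, ?_, ?_⟩)
        · intro e'
          simp only [Finset.mem_sdiff, mem_crossEdges, Finset.mem_erase]
          tauto
        · simpa [mem_crossEdges] using ⟨he.1, fun h => he.2 h⟩
        · simp
      have hu : insert e G ∪ P.erase e = E := by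
        rw [← hE]
        ext e'
        by_cases h : e' = e
        · simp [h, he.1]
        · simp [h]
      obtain ⟨t', h1, h2⟩ := ih _ hlt (h.step (.back par G P l' e he.1 (he.2 he.1))) hu rfl
      exact ⟨t', by omega, h2⟩

theorem reaches_initial : Reaches (∅ : Finset (Sym2 (Fin n))) (fun _ => none) 0 := by
  refine ⟨[], by simp, by simp, by simp, 0, le_rfl, ?_⟩
  have : crossEdges (fun _ : Fin n => none) ∅ = ∅ := by
    ext e
    simp [mem_crossEdges]
  simp only [this]
  exact .start

theorem Reaches.isTree {E : Finset (Sym2 (Fin n))} {par : Fin n → Option (Fin n)} {t : ℕ}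
    (h : Reaches E par t) : IsTree par := by
  obtain ⟨l, -, -, -, t', -, h⟩ := h
  exact h.valid.isTree

/-- Insertion of an edge while no edge is pending. -/
theorem Reaches.insert {E : Finset (Sym2 (Fin n))} {par : Fin n → Option (Fin n)} {t : ℕ}
    (h : Reaches E par t) (hE : ∀ e ∈ E, ¬ IsCrossEdge par e) {e : Sym2 (Fin n)} (he : e ∉ E)
    (hd : ¬ e.IsDiag) : Reaches (insert e E) par t := by
  obtain ⟨l, h1, h2, rfl, t', h3, h4⟩ := h
  have hX : crossEdges par l.toFinset = ∅ := by
    ext e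
    simp only [mem_crossEdges, Finset.notMem_empty, iff_false]
    exact fun h => hE e h.1 h.2
  rw [hX, Finset.sdiff_empty] at h4
  have h5 := (h4.append [e]).step (.insert par _ e [])
  obtain ⟨t'', h6, h7⟩ := h5.exists_saturated (E := Insert.insert e l.toFinset)
    (by rw [Finset.union_comm]; rfl)
  refine ⟨l ++ [e], ?_, ?_, ?_, t'', by omega, h7⟩
  · rw [List.nodup_append]
    refine ⟨h1, by simp, ?_⟩
    rintro a ha b hb rfl
    rw [List.mem_singleton] at hb
    exact he (by simpa [← hb] using ha)
  · simp only [List.mem_append, List.mem_singleton]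
    rintro e' (h | rfl)
    · exact h2 e' h
    · exact hd
  · rw [List.toFinset_append, Finset.union_comm]
    rfl

/-- Processing of a pending cross edge, and of everything that is not a cross edge thereafter. -/
theorem Reaches.reroot {E : Finset (Sym2 (Fin n))} {par par' : Fin n → Option (Fin n)} {t : ℕ}
    (h : Reaches E par t) {v x y : Fin n} (he : s(x, y) ∈ E)
    (hvx : ¬ IsAncestor par (some v) (some x)) (hvy : IsAncestor par (some v) (some y))
    (hx : IsAncestor par (par v) (some x)) (hne : par v ≠ some x)
    (hlow : depth par (some y) ≤ depth par (some x)) (hr : IsReroot par v x y par')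
    {A : Finset (Sym2 (Fin n))} (hAE : A ⊆ E) (hA : ∀ e ∈ A, ¬ IsCrossEdge par e)
    (hA' : ∀ e ∈ A, IsCrossEdge par' e) : Reaches E par' (t + A.card) := by
  have hT := h.isTree
  obtain ⟨l, h1, h2, rfl, t', h3, h4⟩ := h
  set E := l.toFinset
  have hw := hT.isLCA_of_child hvx hvy hx
  have hy : par v ≠ some y := fun h => hT.not_isAncestor_parent v (h ▸ hvy)
  have hc : s(x, y) ∈ crossEdges par E :=
    mem_crossEdges.2 ⟨he, x, y, par v, rfl, hw, hne, hy⟩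
  have h5 := h4.step (.cross par par' _ _ [] x y v (par v) hc hw hne hy hlow rfl hvy hr)
  have hu : Insert.insert s(x, y) ((E \ crossEdges par E) \ crossEdges par' (E \ crossEdges par E)) ∪
      ((crossEdges par E).erase s(x, y) ∪ crossEdges par' (E \ crossEdges par E)) = E := by
    ext e
    by_cases hxy : e = s(x, y)
    · simp [hxy, he]
    · simp only [Finset.mem_union, Finset.mem_insert, Finset.mem_sdiff, Finset.mem_erase,
        mem_crossEdges, hxy]
      tauto
  obtain ⟨t'', h6, h7⟩ := h5.exists_saturated hu
  -- The edges of `A` are not cross edges of `par`, so they are in the graph rather than pending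
  -- when the rebuild happens; all of them are collected.
  have hcard : A.card ≤ (crossEdges par' (E \ crossEdges par E)).card := by
    refine Finset.card_le_card fun e he => ?_
    rw [mem_crossEdges, Finset.mem_sdiff, mem_crossEdges]
    exact ⟨⟨hAE he, fun h => hA e he h.2⟩, hA' e he⟩
  exact ⟨l, h1, h2, rfl, t'', by omega, h7⟩

/-- Every tree whose parents precede their children can be built. -/
theorem exists_reaches_tree {par : Fin n → Option (Fin n)} (hpar : ∀ v p, par v = some p → p < v) :
    ∃ E : Finset (Sym2 (Fin n)), Reaches E par 0 ∧ ∀ e ∈ E, ∃ v p, par v = some p ∧ e = s(p, v) := by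
  have key : ∀ k ≤ n, ∃ E : Finset (Sym2 (Fin n)),
      Reaches E (fun v => if (v : ℕ) < k then par v else none) 0 ∧
      ∀ e ∈ E, ∃ v p, par v = some p ∧ e = s(p, v) ∧ (v : ℕ) < k := by
    intro k hk
    induction k with
    | zero => exact ⟨∅, by simpa using reaches_initial, by simp⟩
    | succ k ih =>
      obtain ⟨E, h1, h2⟩ := ih (by omega)
      set q : Fin n → Option (Fin n) := fun v => if (v : ℕ) < k then par v else none with hq
      have hT : IsTree q := h1.isTree
      set v : Fin n := ⟨k, hk⟩ with hv
      have hqv : q v = none := by simp [hq, hv]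
      set q' : Fin n → Option (Fin n) := fun u => if (u : ℕ) < k + 1 then par u else none with hq'
      have hq'u : ∀ u, u ≠ v → q' u = q u := by
        intro u hu
        have : (u : ℕ) ≠ k := fun h => hu (Fin.ext h)
        simp only [hq, hq', show (u : ℕ) < k + 1 ↔ (u : ℕ) < k by omega]
      have hq'v : q' v = par v := by simp [hq', hv]
      cases hp : par v with
      | none =>
        have : q' = q := by
          funext u
          by_cases hu : u = v
          · rw [hu, hq'v, hqv, hp]
          · exact hq'u u hu
        rw [this]
        exact ⟨E, h1, fun e he => by
          obtain ⟨a, b, c, d, f⟩ := h2 e he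
          exact ⟨a, b, c, d, by omega⟩⟩
      | some p =>
        have hpv : (p : ℕ) < k := hpar v p hp
        -- In `q` the vertex `v` is still an isolated child of the pseudo root: a child of `v` would
        -- have a larger number and is not attached yet. Inserting `(p, v)` therefore hangs just `v`
        -- from `p`.
        have hvleaf : ∀ z : Option (Fin n), IsAncestor q (some v) z → z = some v := by
          intro z
          induction z using hT.induction with
          | h0 => simp [isAncestor_none_iff]
          | hs z ih =>
            intro h
            rcases isAncestor_some_iff.1 h with h | h
            · exact h.symm
            · have h' := ih h
              have : (z : ℕ) < k := by
                by_contra hz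
                simp [hq, hz] at h'
              simp only [hq, this, if_true] at h'
              have := hpar _ _ h'
              simp only [hv, Fin.lt_def] at this
              omega
        have hpne : p ≠ v := by
          rintro rfl
          simp [hv] at hpv
        have hvp : ¬ IsAncestor q (some v) (some p) := fun h =>
          hpne (Option.some_injective _ (hvleaf _ h))
        have hEq : ∀ e ∈ E, ¬ IsCrossEdge q e := by
          intro e he
          obtain ⟨a, b, h3, rfl, h4⟩ := h2 e he
          rw [hT.isCrossEdge_iff]
          refine fun h => h.1 (isAncestor_some_iff.2 (Or.inr ?_))
          simp only [hq, h4, if_true, h3]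
          exact .refl _
        have heE : s(p, v) ∉ E := by
          intro he
          obtain ⟨a, b, h3, h4, h5⟩ := h2 _ he
          have h6 := hpar _ _ h3
          rcases Sym2.eq_iff.1 h4 with ⟨rfl, rfl⟩ | ⟨rfl, rfl⟩
          · simp [hv] at h5
          · simp only [hv, Fin.lt_def] at h6
            omega
        have h3 := h1.insert hEq heE (by simpa using hpne)
        have hr : IsReroot q v p v q' := by
          have hon : ∀ z, OnPath q v v z → z = v := fun z hz =>
            Option.some_injective _ (hvleaf _ hz.1)
          refine ⟨by rw [hq'v, hp], fun a b hb hbv => absurd (hon b hb) hbv, fun z hz => ?_⟩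
          refine hq'u z ?_
          rintro rfl
          exact hz ⟨.refl _, .refl _⟩
        have h4 := h3.reroot (A := ∅) (by simp) hvp (.refl _)
          (by rw [hqv]; exact hT.isAncestor_none _) (by simp [hqv])
          (by rw [hT.depth_some, hT.depth_some, hqv, depth_none]; omega) hr (by simp) (by simp)
          (by simp)
        refine ⟨_, h4, ?_⟩
        intro e he
        rcases Finset.mem_insert.1 he with rfl | he
        · exact ⟨v, p, hp, rfl, by simp [hv]⟩
        · obtain ⟨a, b, c, d, f⟩ := h2 e he
          exact ⟨a, b, c, d, by omega⟩
  obtain ⟨E, h1, h2⟩ := key n le_rfl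
  refine ⟨E, by simpa using h1, fun e he => ?_⟩
  obtain ⟨a, b, c, d, -⟩ := h2 e he
  exact ⟨a, b, c, d⟩

/-- Edges that are not cross edges can be added. -/
theorem Reaches.union {E : Finset (Sym2 (Fin n))} {par : Fin n → Option (Fin n)} {t : ℕ}
    (h : Reaches E par t) (hE : ∀ e ∈ E, ¬ IsCrossEdge par e) (D : Finset (Sym2 (Fin n)))
    (hD : ∀ e ∈ D, ¬ IsCrossEdge par e) (hD' : ∀ e ∈ D, ¬ e.IsDiag) :
    Reaches (D ∪ E) par t := by
  induction D using Finset.induction_on with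
  | empty => simpa using h
  | insert e D he ih =>
    simp only [Finset.mem_insert, forall_eq_or_imp] at hD hD'
    have h1 := ih hD.2 hD'.2
    rw [Finset.insert_union]
    by_cases hmem : e ∈ D ∪ E
    · rwa [Finset.insert_eq_of_mem hmem]
    · refine h1.insert (fun e' he' => ?_) hmem hD'.1
      rcases Finset.mem_union.1 he' with he' | he'
      · exact hD.2 e' he'
      · exact hE e' he'

/-- An execution can be extended to a finished one on a sequence of any possible length. -/
theorem Reaches.exists_finished {E : Finset (Sym2 (Fin n))} {par : Fin n → Option (Fin n)} {t : ℕ}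
    (h : Reaches E par t) {m : ℕ} (hm : E.card ≤ m) (hm' : m ≤ n.choose 2) :
    ∃ l : List (Sym2 (Fin n)), IsInsertionSequence n m l ∧
      ∃ t' σ, t ≤ t' ∧ Execution l t' σ ∧ σ.Finished := by
  classical
  obtain ⟨l, h1, h2, rfl, t', h3, h4⟩ := h
  set U : Finset (Sym2 (Fin n)) := Finset.univ.filter fun e => ¬ e.IsDiag with hU
  have hUc : U.card = n.choose 2 := by
    have := Sym2.card_subtype_not_diag (α := Fin n)
    rw [Fintype.card_subtype, Fintype.card_fin] at this
    exact this
  obtain ⟨D, hD1, hD2, hD3⟩ := Finset.exists_subsuperset_card_eq (s := l.toFinset) (t := U)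
    (fun e he => by simpa [hU] using h2 e (by simpa using he)) hm (hUc ▸ hm')
  -- The missing edges are appended as padding; how they are processed does not matter, since costs
  -- only grow.
  obtain ⟨t'', σ, h5, h6, h7⟩ := (h4.append (D \ l.toFinset).toList).exists_finished
  refine ⟨_, ⟨?_, ?_, ?_⟩, t'', σ, h3.trans h5, h6, h7⟩
  · rw [List.length_append, Finset.length_toList, ← List.toFinset_card_of_nodup h1, add_comm,
      Finset.card_sdiff_add_card_eq_card hD1, hD3]
  · rw [List.nodup_append]
    refine ⟨h1, Finset.nodup_toList _, ?_⟩
    rintro a ha b hb rfl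
    rw [Finset.mem_toList, Finset.mem_sdiff] at hb
    exact hb.2 (by simpa using ha)
  · intro e he
    rcases List.mem_append.1 he with he | he
    · exact h2 e he
    · rw [Finset.mem_toList, Finset.mem_sdiff] at he
      simpa [hU] using hD2 he.1

end ADFS

/-! ### The lower-bound construction: light chain, rows and phases -/

namespace ADFS

variable {n : ℕ}

/-- The vertices of the construction: a chain of `Q + 1` light vertices `c j`, and `K + R` rows
of `2 * K` vertices `d t k` each. -/
structure Layout (n Q K R : ℕ) where
  c : ℕ → Fin n
  d : ℕ → ℕ → Fin n
  c_inj : ∀ i j, i ≤ Q → j ≤ Q → c i = c j → i = j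
  d_inj : ∀ t k t' k', t < K + R → k < 2 * K → t' < K + R → k' < 2 * K → d t k = d t' k' →
    t = t' ∧ k = k'
  c_ne_d : ∀ j t k, j ≤ Q → t < K + R → k < 2 * K → c j ≠ d t k

/-- The number of vertices of row `t` that are used as a path. -/
def rowLength (K t : ℕ) : ℕ := K + min t K

/-- The row to which the hub moves in turn `i` of phase `r`. -/
def turnRow (K r i : ℕ) : ℕ := if i < K then i else K + r

theorem rowLength_le (K t : ℕ) : rowLength K t ≤ 2 * K := by
  unfold rowLength
  omega

theorem rowLength_turnRow {K r i : ℕ} (hi : i ≤ K) : rowLength K (turnRow K r i) = K + i := by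
  unfold rowLength turnRow
  split_ifs <;> omega

theorem turnRow_lt {K R r i : ℕ} (hr : r < R) : turnRow K r i < K + R := by
  unfold turnRow
  split_ifs <;> omega

theorem turnRow_inj {K r i j : ℕ} (hi : i ≤ K) (hj : j ≤ K) (h : turnRow K r i = turnRow K r j) :
    i = j := by
  unfold turnRow at h
  split_ifs at h <;> omega

namespace Layout

variable {Q K R : ℕ} (S : Layout n Q K R)

/-- Row `t`, read in one of its two directions. -/
def row (b : Bool) (t k : ℕ) : Fin n := if b then S.d t k else S.d t (rowLength K t - 1 - k)

/-- Row `t`, read in direction `b`, is a tree path that hangs from `p`. -/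
def Hangs (par : Fin n → Option (Fin n)) (b : Bool) (t : ℕ) (p : Fin n) : Prop :=
  par (S.row b t 0) = some p ∧
    ∀ k < rowLength K t - 1, par (S.row b t (k + 1)) = some (S.row b t k)

theorem exists_row_eq {t : ℕ} (b : Bool) {k : ℕ} (hk : k < rowLength K t) :
    ∃ k' < rowLength K t, S.row b t k = S.d t k' := by
  unfold row
  split_ifs
  · exact ⟨k, hk, rfl⟩
  · exact ⟨_, by omega, rfl⟩

theorem row_inj {b b' : Bool} {t t' k k' : ℕ} (ht : t < K + R) (hk : k < rowLength K t)
    (ht' : t' < K + R) (hk' : k' < rowLength K t') (h : S.row b t k = S.row b' t' k') :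
    t = t' := by
  obtain ⟨i, hi, e⟩ := S.exists_row_eq b hk
  obtain ⟨i', hi', e'⟩ := S.exists_row_eq b' hk'
  rw [e, e'] at h
  exact (S.d_inj _ _ _ _ ht (hi.trans_le (rowLength_le _ _)) ht'
    (hi'.trans_le (rowLength_le _ _)) h).1

theorem row_inj_right {b : Bool} {t k k' : ℕ} (ht : t < K + R) (hk : k < rowLength K t)
    (hk' : k' < rowLength K t) (h : S.row b t k = S.row b t k') : k = k' := by
  have := rowLength_le K t
  unfold row at h
  split_ifs at h
  · exact (S.d_inj _ _ _ _ ht (by omega) ht (by omega) h).2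
  · have := (S.d_inj _ _ _ _ ht (by omega) ht (by omega) h).2
    omega

theorem c_ne_row {j t k : ℕ} (b : Bool) (hj : j ≤ Q) (ht : t < K + R) (hk : k < rowLength K t) :
    S.c j ≠ S.row b t k := by
  obtain ⟨i, hi, e⟩ := S.exists_row_eq b hk
  rw [e]
  exact S.c_ne_d _ _ _ hj ht (hi.trans_le (rowLength_le _ _))

theorem row_not {t k : ℕ} (b : Bool) (hk : k < rowLength K t) :
    S.row (!b) t k = S.row b t (rowLength K t - 1 - k) := by
  cases b
  · simp [row, show rowLength K t - 1 - (rowLength K t - 1 - k) = k by omega]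
  · simp [row]

variable {S} in
theorem Hangs.congr {par par' : Fin n → Option (Fin n)} {b : Bool} {t : ℕ} {p : Fin n}
    (h : S.Hangs par b t p) (hK : 0 < rowLength K t)
    (he : ∀ k < rowLength K t, par' (S.row b t k) = par (S.row b t k)) : S.Hangs par' b t p :=
  ⟨by rw [he 0 hK]; exact h.1, fun k hk => by rw [he _ (by omega)]; exact h.2 k hk⟩

/-- The situation before turn `i` of phase `r`; row `t` is directed as `o t` says. The light
vertices from the hub `c (r + 1)` on form a chain; the rows to come hang from `c r`, those already
used in this phase hang from the hub. -/
structure Situation (par : Fin n → Option (Fin n)) (o : ℕ → Bool) (r i : ℕ) : Prop where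
  chain : ∀ j, r + 1 ≤ j → j < Q → par (S.c (j + 1)) = some (S.c j)
  hub_zero : i = 0 → par (S.c (r + 1)) = some (S.c r)
  hub_succ : ∀ i', i = i' + 1 → par (S.c (r + 1)) =
    some (S.row (o (turnRow K r i')) (turnRow K r i') (rowLength K (turnRow K r i') - 1))
  -- The bound `i ≤ i' + 1` includes row `i - 1`, which has the hub at its end and is reversed only
  -- in the coming turn.
  above : ∀ i' ≤ K, i ≤ i' + 1 → S.Hangs par (o (turnRow K r i')) (turnRow K r i') (S.c r)
  below : ∀ i' < K, i' + 1 < i → S.Hangs par (o i') i' (S.c (r + 1))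
  spare : ∀ r', r < r' → r' < R → S.Hangs par (o (K + r')) (K + r') (S.c r')

variable {S}
variable {par : Fin n → Option (Fin n)} {o : ℕ → Bool} {E : Finset (Sym2 (Fin n))} {T r i : ℕ}

theorem Hangs.isAncestor_iff {b : Bool} {t k : ℕ} {p : Fin n} (h : S.Hangs par b t p)
    (hk : k < rowLength K t) {a : Option (Fin n)} :
    IsAncestor par a (some (S.row b t k)) ↔
      (∃ i ≤ k, a = some (S.row b t i)) ∨ IsAncestor par a (some p) :=
  isAncestor_path_iff h.1 h.2 (by omega)

theorem Hangs.isAncestor {b : Bool} {t k : ℕ} {p : Fin n} (h : S.Hangs par b t p)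
    (hk : k < rowLength K t) : IsAncestor par (some p) (some (S.row b t k)) :=
  (h.isAncestor_iff hk).2 (Or.inr (.refl _))

theorem Hangs.depth_row {b : Bool} {t k : ℕ} {p : Fin n} (h : S.Hangs par b t p)
    (hT : IsTree par) (hk : k < rowLength K t) :
    depth par (some (S.row b t k)) = depth par (some p) + k + 1 :=
  hT.depth_path h.1 h.2 (by omega)

theorem Situation.isAncestor_chain (h : S.Situation par o r i) {j j' : ℕ} (hj : r + 1 ≤ j)
    (hjj : j ≤ j') (hj' : j' ≤ Q) : IsAncestor par (some (S.c j)) (some (S.c j')) := by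
  have := isAncestor_of_path (par := par) (p := fun k => S.c (r + 1 + k)) (L := Q - (r + 1))
    (fun k hk => h.chain (r + 1 + k) (by omega) (by omega)) (i := j - (r + 1)) (j := j' - (r + 1))
    (by omega) (by omega)
  simpa [Nat.add_sub_cancel' hj, Nat.add_sub_cancel' (hj.trans hjj)] using this

theorem Situation.isAncestor_chain_iff (h : S.Situation par o r i) {j : ℕ} (hj : r + 1 ≤ j)
    (hjQ : j ≤ Q) {a : Option (Fin n)} : IsAncestor par a (some (S.c j)) ↔
      (∃ j', r + 2 ≤ j' ∧ j' ≤ j ∧ a = some (S.c j')) ∨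
        IsAncestor par a (some (S.c (r + 1))) := by
  induction j, hj using Nat.le_induction with
  | base =>
    constructor
    · exact Or.inr
    · rintro (⟨j', h1, h2, -⟩ | h)
      · omega
      · exact h
  | succ j hj ih =>
    rw [isAncestor_some_iff, h.chain j hj (by omega), ih (by omega)]
    constructor
    · rintro (h | ⟨j', h1, h2, h3⟩ | h)
      · exact Or.inl ⟨j + 1, by omega, le_rfl, h⟩
      · exact Or.inl ⟨j', h1, by omega, h3⟩
      · exact Or.inr h
    · rintro (⟨j', h1, h2, h3⟩ | h)
      · rcases h2.lt_or_eq with h2 | rfl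
        · exact Or.inr (Or.inl ⟨j', h1, by omega, h3⟩)
        · exact Or.inl h3
      · exact Or.inr (Or.inr h)

/-- The edges between the rows and the light vertices that the construction uses. -/
def HasEdges (S : Layout n Q K R) (E : Finset (Sym2 (Fin n))) : Prop :=
  (∀ j t k, j ≤ Q → t < K → k < 2 * K → s(S.d t k, S.c j) ∈ E) ∧
    ∀ r k, r < R → k < 2 * K → s(S.d (K + r) k, S.c (r + 1)) ∈ E

/-- These are the edges that trigger the turns. The end of a row depends on its direction, so all
its vertices are joined to the hub. An extra row is joined to the hub of its own phase only, which
keeps the number of edges at `O(QK² + RK)`. -/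
theorem HasEdges.turn (hE : S.HasEdges E) (hr : r < R) (hRQ : R ≤ Q) (b : Bool) {k : ℕ}
    (hk : k < rowLength K (turnRow K r i)) :
    s(S.row b (turnRow K r i) k, S.c (r + 1)) ∈ E := by
  obtain ⟨k', hk', e⟩ := S.exists_row_eq b hk
  have h2 := rowLength_le K (turnRow K r i)
  rw [e]
  unfold turnRow at *
  split_ifs at * with h
  · exact hE.1 _ _ _ (by omega) h (by omega)
  · exact hE.2 _ _ hr (by omega)

/-! ### The turns of a phase -/

/-- The first turn of a phase. -/
theorem Situation.first_turn (h : S.Situation par o r 0) (hR : Reaches E par T)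
    (hE : S.HasEdges E) (hK : 0 < K) (hr : r < R) (hRQ : R ≤ Q) :
    ∃ par', Reaches E par' T ∧ S.Situation par' o r 1 := by
  have hT := hR.isTree
  have hub := h.hub_zero rfl
  have hl : rowLength K (turnRow K r 0) = K := rowLength_turnRow (Nat.zero_le _)
  have hang := h.above 0 (Nat.zero_le _) (by omega)
  set x := S.row (o (turnRow K r 0)) (turnRow K r 0) (rowLength K (turnRow K r 0) - 1) with hx
  have hrow : ∀ t < K + R, ∀ k < rowLength K t, ∀ b, S.row b t k ≠ S.c (r + 1) :=
    fun t ht k hk b => (S.c_ne_row b (by omega) ht hk).symm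
  obtain ⟨par', hr'⟩ := hT.exists_isReroot x (IsAncestor.refl (some (S.c (r + 1))))
  -- The hub is itself the child of `c r`, so the reversed path is a single vertex and only the hub
  -- changes its parent.
  obtain ⟨e1, -, e2⟩ := hr'.parent_path hT (p := fun _ => S.c (r + 1)) (L := 0) (by simp)
  have e2 : ∀ z, z ≠ S.c (r + 1) → par' z = par z := fun z hz => e2 z fun k _ => hz
  have hvx : ¬ IsAncestor par (some (S.c (r + 1))) (some x) := by
    rw [hang.isAncestor_iff (by omega)]
    rintro (⟨k, hk, e⟩ | e)
    · exact hrow _ (turnRow_lt hr) _ (by omega) _ (Option.some_injective _ e).symm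
    · exact hT.not_isAncestor_parent _ (hub ▸ e)
  refine ⟨par', ?_, ?_, by omega, ?_, ?_, by omega, ?_⟩
  · have := hR.reroot (A := ∅) (hE.turn hr hRQ _ (by omega)) hvx (.refl _)
      (by rw [hub]; exact hang.isAncestor (by omega)) ?_ ?_ hr' (by simp) (by simp) (by simp)
    · simpa using this
    · rw [hub]
      intro e
      exact S.c_ne_row _ (by omega) (turnRow_lt hr) (by omega) (Option.some_injective _ e)
    · rw [hT.depth_some, hub, hang.depth_row hT (by omega)]
      omega
  · intro j hj hjQ
    rw [e2, h.chain j hj hjQ]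
    intro e
    have := S.c_inj _ _ (by omega) (by omega) e
    omega
  · intro i' hi'
    obtain rfl : i' = 0 := by omega
    exact e1
  · intro i' hi' _
    exact (h.above i' hi' (by omega)).congr (by rw [rowLength_turnRow hi']; omega)
      fun k hk => e2 _ (hrow _ (turnRow_lt hr) _ hk _)
  · intro r' h1 h2
    exact (h.spare r' h1 h2).congr (by unfold rowLength; omega)
      fun k hk => e2 _ (hrow _ (by omega) _ hk _)

/-- A later turn of a phase, which reverses a row. -/
theorem Situation.next_turn (h : S.Situation par o r (i + 1)) (hR : Reaches E par T)
    (hE : S.HasEdges E) (hi : i < K) (hr : r < R) (hRQ : R ≤ Q) :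
    ∃ par' o', Reaches E par' (T + K * (Q - R)) ∧ S.Situation par' o' r (i + 2) := by
  have hT := hR.isTree
  have hti : turnRow K r i = i := if_pos hi
  have hli : rowLength K i = K + i := by unfold rowLength; omega
  have hl : rowLength K (turnRow K r (i + 1)) = K + (i + 1) := rowLength_turnRow hi
  have hub := h.hub_succ i rfl
  have hang := h.above i hi.le (by omega)
  have hang' := h.above (i + 1) hi (by omega)
  rw [hti] at hub hang
  set t' := turnRow K r (i + 1) with ht'
  have ht'R : t' < K + R := turnRow_lt hr
  have htt' : t' ≠ i := by
    rw [← hti]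
    intro e
    have := turnRow_inj hi hi.le e
    omega
  set x := S.row (o t') t' (rowLength K t' - 1) with hx
  -- The path to be reversed: row `i`, read downwards, and then the hub at index `K + i`.
  set p : ℕ → Fin n := fun k => if k < K + i then S.row (o i) i k else S.c (r + 1) with hp
  have hpl : ∀ k < K + i, p k = S.row (o i) i k := fun k hk => if_pos hk
  have hpL : p (K + i) = S.c (r + 1) := if_neg (lt_irrefl _)
  have hpar : ∀ k < K + i, par (p (k + 1)) = some (p k) := by
    intro k hk
    by_cases hk' : k + 1 < K + i
    · rw [hpl _ hk, hpl _ hk']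
      exact hang.2 k (by omega)
    · obtain rfl : k = K + i - 1 := by omega
      rw [show K + i - 1 + 1 = K + i by omega, hpL, hpl _ hk, hub, hli]
  have hp0 : par (p 0) = some (S.c r) := by
    rw [hpl _ (by omega)]
    exact hang.1
  have hvy : IsAncestor par (some (p 0)) (some (p (K + i))) :=
    isAncestor_of_path hpar (Nat.zero_le _) le_rfl
  have hvx : ¬ IsAncestor par (some (p 0)) (some x) := by
    rw [hang'.isAncestor_iff (by omega)]
    rintro (⟨k, hk, e⟩ | e)
    · rw [hpl _ (by omega)] at e
      exact htt' (S.row_inj (by omega) (by omega) ht'R (by omega) (Option.some_injective _ e)).symm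
    · exact hT.not_isAncestor_parent _ (hp0 ▸ e)
  obtain ⟨par', hr'⟩ := hT.exists_isReroot x hvy
  have hT' := hr'.isTree hT hvx hvy
  obtain ⟨e1, e2, e3⟩ := hr'.parent_path hT hpar
  rw [hpL] at e1
  have e3c : ∀ j ≤ Q, j ≠ r + 1 → par' (S.c j) = par (S.c j) := by
    refine fun j hj hjr => e3 _ fun k hk e => ?_
    rcases hk.lt_or_eq with hk | rfl
    · rw [hpl _ hk] at e
      exact S.c_ne_row _ hj (by omega) (by omega) e
    · rw [hpL] at e
      exact hjr (S.c_inj _ _ hj (by omega) e)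
  have e3d : ∀ t < K + R, t ≠ i → ∀ b, ∀ k < rowLength K t,
      par' (S.row b t k) = par (S.row b t k) := by
    refine fun t ht hti b k hk => e3 _ fun k' hk' e => ?_
    rcases hk'.lt_or_eq with hk' | rfl
    · rw [hpl _ hk'] at e
      exact hti (S.row_inj ht hk (by omega) (by omega) e)
    · rw [hpL] at e
      exact S.c_ne_row _ (by omega) ht hk e.symm
  set o' := Function.update o i (!o i) with ho'
  have ho'i : o' i = !o i := Function.update_self ..
  have ho't : ∀ t, t ≠ i → o' t = o t := fun t ht => Function.update_of_ne ht ..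
  have hangt : ∀ t < K + R, t ≠ i → ∀ z, S.Hangs par (o t) t z → S.Hangs par' (o' t) t z := by
    intro t ht hti z hz
    rw [ho't t hti]
    exact hz.congr (by unfold rowLength; omega) (e3d t ht hti _)
  have hangi : S.Hangs par' (o' i) i (S.c (r + 1)) := by
    rw [ho'i]
    constructor
    · rw [S.row_not _ (by omega), ← hpl _ (by omega), e2 _ (by omega), ← hpL]
      congr 2
      omega
    · intro k hk
      rw [S.row_not _ (by omega), S.row_not _ (by omega), ← hpl _ (by omega), ← hpl _ (by omega),
        e2 _ (by omega)]
      congr 2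
      omega
  have hsit : S.Situation par' o' r (i + 2) := by
    refine ⟨?_, by omega, ?_, ?_, ?_, ?_⟩
    · intro j hj hjQ
      rw [e3c _ (by omega) (by omega), h.chain j hj hjQ]
    · intro i' hi'
      obtain rfl : i' = i + 1 := by omega
      rw [← ht', ho't _ htt']
      exact e1
    · intro i' hi' hii'
      refine hangt _ (turnRow_lt hr) ?_ _ (h.above i' hi' (by omega))
      rw [← hti]
      intro e
      have := turnRow_inj hi' hi.le e
      omega
    · intro i' hi' hii'
      by_cases hii : i' = i
      · rw [hii]
        exact hangi
      · exact hangt _ (by omega) hii _ (h.below i' hi' (by omega))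
    · intro r' h1 h2
      exact hangt _ (by omega) (by omega) _ (h.spare r' h1 h2)
  refine ⟨par', o', ?_, hsit⟩
  -- Equality holds: row `i + 1` has one vertex more than row `i`, so its end is exactly as deep as
  -- the hub. This is why row lengths grow by one.
  have hlow : depth par (some (p (K + i))) ≤ depth par (some x) := by
    rw [hT.depth_path hp0 hpar le_rfl, hang'.depth_row hT (by omega)]
    omega
  -- The hub `c (r + 1)` is left out: the reversed row hangs from it, so its edges to the hub do not
  -- become cross edges.
  set A : Finset (Sym2 (Fin n)) := (Finset.range (K + i) ×ˢ Finset.Ioc (r + 1) Q).image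
    fun kj => s(S.row (o i) i kj.1, S.c kj.2) with hA
  have hAc : A.card = (K + i) * (Q - (r + 1)) := by
    rw [hA, Finset.card_image_of_injOn, Finset.card_product, Finset.card_range, Nat.card_Ioc]
    rintro ⟨k, j⟩ hkj ⟨k', j'⟩ hkj' e
    simp only [Finset.coe_product, Finset.coe_range, Finset.coe_Ioc, Set.mem_prod, Set.mem_Iio,
      Set.mem_Ioc] at hkj hkj'
    rcases Sym2.eq_iff.1 e with ⟨h1, h2⟩ | ⟨h1, h2⟩
    · exact Prod.ext (S.row_inj_right (by omega) (by omega) (by omega) h1)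
        (S.c_inj _ _ (by omega) (by omega) h2)
    · exact absurd h1.symm (S.c_ne_row _ (by omega) (by omega) (by omega))
  have hmemA : ∀ e ∈ A, ∃ k j, k < K + i ∧ r + 2 ≤ j ∧ j ≤ Q ∧
      e = s(S.row (o i) i k, S.c j) := by
    intro e he
    simp only [hA, Finset.mem_image, Finset.mem_product, Finset.mem_range, Finset.mem_Ioc,
      Prod.exists] at he
    obtain ⟨k, j, h1, rfl⟩ := he
    exact ⟨k, j, h1.1, h1.2.1, h1.2.2, rfl⟩
  have hres := hR.reroot (A := A) (v := p 0) (x := x) (y := p (K + i))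
    (by rw [hpL]; exact hE.turn (i := i + 1) hr hRQ _ (by rw [← ht', hl]; omega)) hvx hvy
    (by rw [hp0]; exact hang'.isAncestor (by omega))
    (by
      rw [hp0]
      intro e
      exact S.c_ne_row _ (by omega) ht'R (by omega) (Option.some_injective _ e))
    hlow hr' ?_ ?_ ?_
  -- The exact count `(K + i) * (Q - (r + 1))` is weakened to a bound independent of turn and phase.
  · obtain ⟨l, h1, h2, h3, t, h4, h5⟩ := hres
    refine ⟨l, h1, h2, h3, t, le_trans ?_ h4, h5⟩
    rw [hAc]
    exact Nat.add_le_add_left (Nat.mul_le_mul (by omega) (by omega)) _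
  · intro e he
    obtain ⟨k, j, hk, hj, hjQ, rfl⟩ := hmemA e he
    obtain ⟨k', hk', e'⟩ := S.exists_row_eq (o i) (t := i) (k := k) (by omega)
    rw [e']
    exact hE.1 _ _ _ hjQ hi (by omega)
  · intro e he
    obtain ⟨k, j, hk, hj, hjQ, rfl⟩ := hmemA e he
    rw [hT.isCrossEdge_iff]
    refine fun hc => hc.1 ?_
    have := isAncestor_of_path hpar hk.le le_rfl
    rw [hpl _ hk, hpL] at this
    exact this.trans (h.isAncestor_chain le_rfl (by omega) hjQ)
  · intro e he
    obtain ⟨k, j, hk, hj, hjQ, rfl⟩ := hmemA e he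
    have hk' : K + i - 1 - k < rowLength K i := by omega
    have hrow : S.row (o i) i k = S.row (o' i) i (K + i - 1 - k) := by
      rw [ho'i, S.row_not _ hk']
      congr 1
      omega
    have hroot : IsAncestor par' (some (S.c (r + 1))) (some (S.row (o i) i k)) := by
      rw [hrow]
      exact hangi.isAncestor hk'
    -- The reversed row and the rest of the light chain are now two separate branches below the hub.
    rw [hT'.isCrossEdge_iff]
    constructor
    · rw [hsit.isAncestor_chain_iff (by omega) hjQ]
      rintro (⟨j', h1, h2, h3⟩ | h1)
      · exact S.c_ne_row _ (by omega) (by omega) (by omega) (Option.some_injective _ h3).symm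
      · exact S.c_ne_row _ (by omega) (by omega) (by omega)
          (Option.some_injective _ (hT'.antisymm hroot h1))
    · nth_rw 1 [hrow]
      rw [hangi.isAncestor_iff hk']
      rintro (⟨k', h1, h2⟩ | h1)
      · exact S.c_ne_row _ hjQ (by omega) (by omega) (Option.some_injective _ h2)
      · have h2 := hsit.isAncestor_chain (j := r + 1) (j' := j) le_rfl (by omega) hjQ
        have := S.c_inj _ _ hjQ (by omega) (Option.some_injective _ (hT'.antisymm h1 h2))
        omega

theorem Situation.phase (h : S.Situation par o r 0) (hR : Reaches E par T)
    (hE : S.HasEdges E) (hK : 0 < K) (hr : r < R) (hRQ : R ≤ Q) :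
    ∃ par' o', Reaches E par' (T + K * (K * (Q - R))) ∧ S.Situation par' o' r (K + 1) := by
  have key : ∀ i ≤ K, ∃ par' o', Reaches E par' (T + i * (K * (Q - R))) ∧
      S.Situation par' o' r (i + 1) := by
    intro i hi
    induction i with
    | zero =>
      obtain ⟨par', h1, h2⟩ := h.first_turn hR hE hK hr hRQ
      exact ⟨par', o, by simpa using h1, h2⟩
    | succ i ih =>
      obtain ⟨par', o', h1, h2⟩ := ih (by omega)
      obtain ⟨par'', o'', h3, h4⟩ := h2.next_turn h1 hE hi hr hRQ
      exact ⟨par'', o'', by rwa [add_mul, one_mul, ← add_assoc], h4⟩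
  exact key K le_rfl

/-- After turn `K` the rows `0, ..., K - 1` all hang from the hub `c (r + 1)`, and so does the
unused extra row `K + (r + 1)`. The old hub becomes the anchor, its chain child `c (r + 2)` the new
hub. -/
theorem Situation.next_phase (h : S.Situation par o r (K + 1)) (hr : r + 1 < R) (hRQ : R ≤ Q) :
    S.Situation par o (r + 1) 0 where
  chain j hj := h.chain j (by omega)
  hub_zero _ := h.chain (r + 1) le_rfl (by omega)
  hub_succ i' hi' := by omega
  above i' hi' _ := by
    unfold turnRow
    split_ifs with hlt
    · exact h.below i' hlt (by omega)
    · exact h.spare (r + 1) (by omega) hr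
  below i' _ hi' := by omega
  spare r' h1 := h.spare r' (by omega)

theorem Situation.phases (h : S.Situation par o 0 0) (hR : Reaches E par 0)
    (hE : S.HasEdges E) (hK : 0 < K) (hR0 : 0 < R) (hRQ : R ≤ Q) :
    ∃ par', Reaches E par' (R * (K * (K * (Q - R)))) := by
  have key : ∀ r < R, ∃ par' o', Reaches E par' (r * (K * (K * (Q - R)))) ∧
      S.Situation par' o' r 0 := by
    intro r hr
    induction r with
    | zero => exact ⟨par, o, by simpa using hR, h⟩
    | succ r ih =>
      obtain ⟨par', o', h1, h2⟩ := ih (by omega)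
      obtain ⟨par'', o'', h3, h4⟩ := h2.phase h1 hE hK (by omega) hRQ
      exact ⟨par'', o'', by rwa [add_mul, one_mul], h4.next_phase hr hRQ⟩
  -- The last phase is run separately: no extra row is left for a situation after it.
  obtain ⟨par', o', h1, h2⟩ := key (R - 1) (by omega)
  obtain ⟨par'', o'', h3, -⟩ := h2.phase h1 hE hK (by omega) hRQ
  refine ⟨par'', ?_⟩
  nth_rw 1 [show R = R - 1 + 1 by omega]
  rwa [add_mul, one_mul]

end Layout

end ADFS

/-! ### The start tree and the first situation -/

namespace ADFS

variable {n : ℕ}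

/-- The vertex with number `i`. -/
def vertex (hn : 0 < n) (i : ℕ) : Fin n := ⟨i % n, Nat.mod_lt _ hn⟩

theorem vertex_inj (hn : 0 < n) {i j : ℕ} (hi : i < n) (hj : j < n)
    (h : vertex hn i = vertex hn j) : i = j := by
  have := congrArg Fin.val h
  simpa [vertex, Nat.mod_eq_of_lt hi, Nat.mod_eq_of_lt hj] using this

/-- The number of vertices of the construction. -/
def layoutSize (Q K R : ℕ) : ℕ := 2 * Q + 2 + (K + R) * (2 * K)

theorem row_index_lt {K R t k : ℕ} (Q : ℕ) (ht : t < K + R) (hk : k < 2 * K) :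
    2 * Q + 2 + t * (2 * K) + k < layoutSize Q K R := by
  have : (t + 1) * (2 * K) ≤ (K + R) * (2 * K) := Nat.mul_le_mul_right _ ht
  rw [add_mul, one_mul] at this
  unfold layoutSize
  omega

/-- The layout in which the light chain is followed by the rows. -/
def layout (hn : 0 < n) (Q K R : ℕ) (hN : layoutSize Q K R ≤ n) : Layout n Q K R where
  -- The numbering decreases along the chain because the start tree has `c Q` on top, and
  -- `exists_reaches_tree` needs parents with smaller numbers.
  c j := vertex hn (2 * Q + 1 - j)
  d t k := vertex hn (2 * Q + 2 + t * (2 * K) + k)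
  c_inj i j hi hj h := by
    have hN' : 2 * Q + 2 ≤ n := (Nat.le_add_right _ _).trans hN
    have := vertex_inj hn (by omega) (by omega) h
    omega
  d_inj t k t' k' ht hk ht' hk' h := by
    have h1 := vertex_inj hn ((row_index_lt Q ht hk).trans_le hN)
      ((row_index_lt Q ht' hk').trans_le hN) h
    have h2 : t * (2 * K) + k = t' * (2 * K) + k' := by omega
    have h3 : t = t' := by
      have := congrArg (· / (2 * K)) h2
      simpa [mul_comm _ (2 * K), Nat.mul_add_div (by omega : 2 * K > 0), Nat.div_eq_of_lt hk,
        Nat.div_eq_of_lt hk'] using this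
    subst h3
    exact ⟨rfl, by omega⟩
  c_ne_d j t k hj ht hk h := by
    have hN' : 2 * Q + 2 ≤ n := (Nat.le_add_right _ _).trans hN
    have := vertex_inj hn (by omega) ((row_index_lt Q ht hk).trans_le hN) h
    omega

/-- The number of the parent of vertex `i` in the tree that is built first: two chains, and every
row hanging from a vertex of the second chain. -/
def startCode (Q K R i : ℕ) : Option ℕ :=
  if i = 0 ∨ i = Q + 1 ∨ layoutSize Q K R ≤ i then none
  else if i < 2 * Q + 2 ∨ (i - (2 * Q + 2)) % (2 * K) ≠ 0 then some (i - 1)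
  -- The quotient is the row number `t`. By truncated subtraction the rows `t < K` hang from `c 0`
  -- and row `K + r` hangs from `c r`.
  else some (2 * Q + 1 - ((i - (2 * Q + 2)) / (2 * K) - K))

/-- The tree that is built first. -/
def startTree (hn : 0 < n) (Q K R : ℕ) (v : Fin n) : Option (Fin n) :=
  (startCode Q K R v).map (vertex hn)

section StartTree

variable {Q K R : ℕ} (hn : 0 < n) (hN : layoutSize Q K R ≤ n)


theorem startTree_vertex {i : ℕ} (hi : i < n) :
    startTree hn Q K R (vertex hn i) = (startCode Q K R i).map (vertex hn) := by
  simp [startTree, vertex, Nat.mod_eq_of_lt hi]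

theorem startTree_lt {v p : Fin n} (h : startTree hn Q K R v = some p) :
    p < v ∧ (v : ℕ) < layoutSize Q K R := by
  have key : ∀ i, startCode Q K R v = some i → i < (v : ℕ) ∧ (v : ℕ) < layoutSize Q K R := by
    intro i hi
    unfold startCode at hi
    split_ifs at hi with h1 h2
    · simp only [Option.some.injEq] at hi
      omega
    · simp only [Option.some.injEq] at hi
      omega
  obtain ⟨i, hi, rfl⟩ := Option.map_eq_some_iff.1 h
  have := key i hi
  refine ⟨?_, this.2⟩
  rw [Fin.lt_def]
  have h3 := v.2
  simp only [vertex]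
  rw [Nat.mod_eq_of_lt (by omega)]
  exact this.1

theorem startTree_zero : startTree hn Q K R (vertex hn 0) = none := by
  rw [startTree_vertex hn hn]
  simp [startCode]

theorem startTree_upper (hN : layoutSize Q K R ≤ n) {i : ℕ} (hi : i < Q) :
    startTree hn Q K R (vertex hn (i + 1)) = some (vertex hn i) := by
  have hN' : 2 * Q + 2 ≤ layoutSize Q K R := Nat.le_add_right _ _
  rw [startTree_vertex hn (by omega), startCode, if_neg (by omega), if_pos (by omega)]
  rfl

theorem startTree_c_last : startTree hn Q K R ((layout hn Q K R hN).c Q) = none := by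
  have hN' : 2 * Q + 2 ≤ layoutSize Q K R := Nat.le_add_right _ _
  change startTree hn Q K R (vertex hn (2 * Q + 1 - Q)) = none
  rw [startTree_vertex hn (by omega), startCode, if_pos (by omega)]
  rfl

theorem startTree_c {j : ℕ} (hj : j < Q) : startTree hn Q K R ((layout hn Q K R hN).c j) =
    some ((layout hn Q K R hN).c (j + 1)) := by
  have hN' : 2 * Q + 2 ≤ layoutSize Q K R := Nat.le_add_right _ _
  change startTree hn Q K R (vertex hn (2 * Q + 1 - j)) = some (vertex hn (2 * Q + 1 - (j + 1)))
  rw [startTree_vertex hn (by omega), startCode, if_neg (by omega), if_pos (by omega)]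
  rfl

theorem startTree_d_zero (hK : 0 < K) {t : ℕ} (ht : t < K + R) :
    startTree hn Q K R ((layout hn Q K R hN).d t 0) =
      some ((layout hn Q K R hN).c (t - K)) := by
  have h := row_index_lt (k := 0) Q ht (by omega)
  change startTree hn Q K R (vertex hn (2 * Q + 2 + t * (2 * K) + 0)) =
    some (vertex hn (2 * Q + 1 - (t - K)))
  have e : 2 * Q + 2 + t * (2 * K) + 0 - (2 * Q + 2) = t * (2 * K) := by omega
  rw [startTree_vertex hn (by omega), startCode, if_neg (by omega), e,
    Nat.mul_mod_left, Nat.mul_div_cancel _ (by omega), if_neg (by omega)]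
  rfl

theorem startTree_d_succ {t k : ℕ} (ht : t < K + R) (hk : k + 1 < 2 * K) :
    startTree hn Q K R ((layout hn Q K R hN).d t (k + 1)) =
      some ((layout hn Q K R hN).d t k) := by
  have h := row_index_lt (k := k + 1) Q ht (by omega)
  change startTree hn Q K R (vertex hn (2 * Q + 2 + t * (2 * K) + (k + 1))) =
    some (vertex hn (2 * Q + 2 + t * (2 * K) + k))
  have e : 2 * Q + 2 + t * (2 * K) + (k + 1) - (2 * Q + 2) = k + 1 + t * (2 * K) := by omega
  rw [startTree_vertex hn (by omega), startCode, if_neg (by omega), e,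
    Nat.add_mul_mod_self_right, Nat.mod_eq_of_lt hk, if_pos (by omega)]
  rfl

theorem startTree_isAncestor_c {i j : ℕ} (hij : i ≤ j) (hj : j ≤ Q) :
    IsAncestor (startTree hn Q K R) (some ((layout hn Q K R hN).c j))
      (some ((layout hn Q K R hN).c i)) := by
  have := isAncestor_of_path (par := startTree hn Q K R)
    (p := fun k => (layout hn Q K R hN).c (Q - k)) (L := Q) ?_ (i := Q - j) (j := Q - i)
    (by omega) (by omega)
  · simpa [Nat.sub_sub_self hj, Nat.sub_sub_self (hij.trans hj)] using this
  · intro k hk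
    rw [startTree_c hn hN (by omega)]
    congr 2
    omega

theorem startTree_isAncestor_d {t k : ℕ} (ht : t < K + R) (hk : k < 2 * K) :
    IsAncestor (startTree hn Q K R) (some ((layout hn Q K R hN).c (t - K)))
      (some ((layout hn Q K R hN).d t k)) :=
  (isAncestor_path_iff (L := 2 * K - 1) (startTree_d_zero hn hN (by omega) ht)
    (fun k hk => startTree_d_succ hn hN ht (by omega)) (by omega)).2 (Or.inr (.refl _))

/-- The first edge set: all edges that the phases use are back edges of the start tree. -/
theorem exists_reaches_startTree (hRQ : R ≤ Q) :
    ∃ E : Finset (Sym2 (Fin n)), Reaches E (startTree hn Q K R) 0 ∧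
      (∀ e ∈ E, ¬ IsCrossEdge (startTree hn Q K R) e) ∧ (layout hn Q K R hN).HasEdges E ∧
      E.card ≤ (Q + 1) * (K * (2 * K)) + R * (2 * K) + layoutSize Q K R := by
  obtain ⟨E, hE, hE'⟩ := exists_reaches_tree (par := startTree hn Q K R)
    fun v p h => (startTree_lt hn h).1
  have hT := hE.isTree
  set S := layout hn Q K R hN
  set D₁ : Finset (Sym2 (Fin n)) :=
    (Finset.range (Q + 1) ×ˢ Finset.range K ×ˢ Finset.range (2 * K)).image
      fun q => s(S.d q.2.1 q.2.2, S.c q.1) with hD₁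
  set D₂ : Finset (Sym2 (Fin n)) := (Finset.range R ×ˢ Finset.range (2 * K)).image
      fun q => s(S.d (K + q.1) q.2, S.c (q.1 + 1)) with hD₂
  have hED : ∀ e ∈ E, ¬ IsCrossEdge (startTree hn Q K R) e := by
    intro e he
    obtain ⟨v, p, h, rfl⟩ := hE' e he
    rw [hT.isCrossEdge_iff]
    exact fun hc => hc.1 (h ▸ isAncestor_parent v)
  have hD : ∀ e ∈ D₁ ∪ D₂, ∃ j t k, j ≤ Q ∧ t < K + R ∧ k < 2 * K ∧ t - K ≤ j ∧
      e = s(S.d t k, S.c j) := by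
    intro e he
    rcases Finset.mem_union.1 he with he | he
    · simp only [hD₁, Finset.mem_image, Finset.mem_product, Finset.mem_range, Prod.exists] at he
      obtain ⟨j, t, k, h, rfl⟩ := he
      exact ⟨j, t, k, by omega, by omega, by omega, by omega, rfl⟩
    · simp only [hD₂, Finset.mem_image, Finset.mem_product, Finset.mem_range, Prod.exists] at he
      obtain ⟨r, k, h, rfl⟩ := he
      exact ⟨r + 1, K + r, k, by omega, by omega, by omega, by omega, rfl⟩
  have hDc : ∀ e ∈ D₁ ∪ D₂, ¬ IsCrossEdge (startTree hn Q K R) e := by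
    intro e he
    obtain ⟨j, t, k, hj, ht, hk, htj, rfl⟩ := hD e he
    rw [hT.isCrossEdge_iff]
    -- In the upside-down chain `c j` lies above `c (t - K)` whenever `t - K ≤ j`, hence above all
    -- of row `t`.
    exact fun hc => hc.2 ((startTree_isAncestor_c hn hN htj hj).trans
      (startTree_isAncestor_d hn hN ht hk))
  refine ⟨(D₁ ∪ D₂) ∪ E, hE.union hED _ hDc ?_, ?_, ⟨?_, ?_⟩, ?_⟩
  · intro e he
    obtain ⟨j, t, k, hj, ht, hk, htj, rfl⟩ := hD e he
    rw [Sym2.mk_isDiag_iff]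
    exact (S.c_ne_d _ _ _ hj ht hk).symm
  · intro e he
    rcases Finset.mem_union.1 he with he | he
    · exact hDc e he
    · exact hED e he
  · intro j t k hj ht hk
    refine Finset.mem_union_left _ (Finset.mem_union_left _ (Finset.mem_image.2 ⟨(j, t, k), ?_, rfl⟩))
    simp only [Finset.mem_product, Finset.mem_range]
    omega
  · intro r k hr hk
    refine Finset.mem_union_left _ (Finset.mem_union_right _ (Finset.mem_image.2 ⟨(r, k), ?_, rfl⟩))
    simp only [Finset.mem_product, Finset.mem_range]
    omega
  · refine (Finset.card_union_le _ _).trans (add_le_add ((Finset.card_union_le _ _).trans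
      (add_le_add ?_ ?_)) ?_)
    · exact Finset.card_image_le.trans (by simp)
    · exact Finset.card_image_le.trans (by simp)
    -- A tree edge is determined by its lower end. The default of `getD` occurs only at children of
    -- the pseudo root and merely enlarges the image.
    · have hsub : E ⊆ (Finset.range (layoutSize Q K R)).image fun i =>
          s(((startTree hn Q K R) (vertex hn i)).getD (vertex hn i), vertex hn i) := by
        intro e he
        obtain ⟨v, p, h, rfl⟩ := hE' e he
        have hv : vertex hn v = v := Fin.ext (Nat.mod_eq_of_lt v.2)
        exact Finset.mem_image.2 ⟨v, Finset.mem_range.2 (startTree_lt hn h).2,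
          by simp [hv, h]⟩
      exact (Finset.card_le_card hsub).trans (Finset.card_image_le.trans (by simp))

/-- The last insertion turns the light chain upside down, and the first phase can start. -/
theorem exists_situation (hK : 0 < K) (hR : 0 < R) (hRQ : R ≤ Q) :
    ∃ (E : Finset (Sym2 (Fin n))) (par : Fin n → Option (Fin n)), Reaches E par 0 ∧
      (layout hn Q K R hN).HasEdges E ∧
      (layout hn Q K R hN).Situation par (fun _ => true) 0 0 ∧
      E.card ≤ (Q + 1) * (K * (2 * K)) + R * (2 * K) + layoutSize Q K R + 1 := by
  obtain ⟨E, hE, hEc, hEd, hcard⟩ := exists_reaches_startTree hn hN hRQ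
  have hN' : 2 * Q + 2 ≤ layoutSize Q K R := Nat.le_add_right _ _
  have hT := hE.isTree
  have hcu : ∀ i ≤ Q, ∀ j ≤ Q, (layout hn Q K R hN).c j ≠ vertex hn i := by
    intro i hi j hj e
    have := vertex_inj hn (by omega) (by omega) e
    omega
  set S := layout hn Q K R hN
  set x := vertex hn Q with hx
  -- The light chain from its top `c Q` down to `c 0`; the edge from `x`, the end of the auxiliary
  -- chain, to `c 0` reverses it.
  set p : ℕ → Fin n := fun k => S.c (Q - k) with hp
  have hp0 : startTree hn Q K R (p 0) = none := by
    rw [hp]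
    exact startTree_c_last hn hN
  have hpar : ∀ k < Q, startTree hn Q K R (p (k + 1)) = some (p k) := by
    intro k hk
    simp only [hp]
    rw [startTree_c hn hN (by omega)]
    congr 2
    omega
  have hpx : ∀ k, ¬ IsAncestor (startTree hn Q K R) (some (p k)) (some x) := by
    intro k
    rw [hx, isAncestor_path_iff (p := vertex hn) (L := Q) (startTree_zero hn)
      (fun k hk => startTree_upper hn hN hk) le_rfl]
    rintro (⟨i, hi, e⟩ | e)
    · exact hcu i hi _ (Nat.sub_le _ _) (Option.some_injective _ e)
    · simp [isAncestor_none_iff] at e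
  have hxp : ¬ IsAncestor (startTree hn Q K R) (some x) (some (p Q)) := by
    rw [isAncestor_path_iff hp0 hpar le_rfl]
    rintro (⟨i, hi, e⟩ | e)
    · exact hcu Q le_rfl _ (Nat.sub_le _ _) (Option.some_injective _ e).symm
    · simp [isAncestor_none_iff] at e
  have hcross := hT.isCrossEdge_iff.2 ⟨hxp, hpx Q⟩
  have h1 := hE.insert hEc (e := s(x, p Q)) (fun h => hEc _ h hcross)
    (by rw [Sym2.mk_isDiag_iff]; exact (hcu Q le_rfl _ (Nat.sub_le _ _)).symm)
  have hvy := isAncestor_of_path hpar (Nat.zero_le Q) le_rfl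
  obtain ⟨par', hr⟩ := hT.exists_isReroot x hvy
  have h2 := h1.reroot (A := ∅) (by simp) (hpx 0) hvy (by rw [hp0]; exact hT.isAncestor_none _)
    (by simp [hp0]) ?_ hr (by simp) (by simp) (by simp)
  · obtain ⟨-, e2, e3⟩ := hr.parent_path hT hpar
    have hchain : ∀ j < Q, par' (S.c (j + 1)) = some (S.c j) := by
      intro j hj
      have := e2 (Q - (j + 1)) (by omega)
      simp only [hp] at this
      rwa [show Q - (Q - (j + 1)) = j + 1 by omega,
        show Q - (Q - (j + 1) + 1) = j by omega] at this
    have hd : ∀ t < K + R, ∀ k < 2 * K, par' (S.d t k) = startTree hn Q K R (S.d t k) :=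
      fun t ht k hk => e3 _ fun i _ => (S.c_ne_d _ _ _ (Nat.sub_le _ _) ht hk).symm
    have hang : ∀ t < K + R, S.Hangs par' true t (S.c (t - K)) := by
      intro t ht
      have hl := rowLength_le K t
      constructor
      · exact (hd t ht 0 (by omega)).trans (startTree_d_zero hn hN hK ht)
      · exact fun k hk => (hd t ht (k + 1) (by omega)).trans
          (startTree_d_succ hn hN ht (by omega))
    refine ⟨_, par', h2, ⟨fun j t k hj ht hk => Finset.mem_insert_of_mem (hEd.1 j t k hj ht hk),
      fun r k hr hk => Finset.mem_insert_of_mem (hEd.2 r k hr hk)⟩,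
      ⟨fun j _ hj => hchain j hj, fun _ => hchain 0 (by omega), by omega, ?_, by omega, ?_⟩,
      (Finset.card_insert_le _ _).trans (by omega)⟩
    · intro i hi _
      have := hang (turnRow K 0 i) (turnRow_lt hR)
      rwa [show turnRow K 0 i - K = 0 by unfold turnRow; split_ifs <;> omega] at this
    · intro r _ hr
      have := hang (K + r) (by omega)
      rwa [Nat.add_sub_cancel_left] at this
  -- Both chains have `Q + 1` vertices, so their ends are equally deep; the auxiliary chain exists
  -- for this reason only.
  · rw [hT.depth_path hp0 hpar le_rfl, hT.depth_path (p := vertex hn) (L := Q)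
      (startTree_zero hn) (fun k hk => startTree_upper hn hN hk) le_rfl]

theorem exists_reaches_costly (hn : 0 < n) (hN : layoutSize Q K R ≤ n) (hK : 0 < K) (hR : 0 < R) (hRQ : R ≤ Q) :
    ∃ (E : Finset (Sym2 (Fin n))) (par : Fin n → Option (Fin n)),
      Reaches E par (R * (K * (K * (Q - R)))) ∧
      E.card ≤ (Q + 1) * (K * (2 * K)) + R * (2 * K) + layoutSize Q K R + 1 := by
  obtain ⟨E, par, h1, h2, h3, h4⟩ := exists_situation hn hN hK hR hRQ
  obtain ⟨par', h5⟩ := h3.phases h1 h2 hK hR hRQ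
  exact ⟨E, par', h5, h4⟩

end StartTree

end ADFS

/-! ### Choice of parameters and constants -/

namespace ADFS

theorem rpow_bound_eq (n m : ℕ) :
    (n : ℝ) ^ (3 / 2 : ℝ) * (m : ℝ) ^ (1 / 2 : ℝ) = n * √n * √m := by
  rw [← Real.sqrt_eq_rpow, show (3 / 2 : ℝ) = 1 + 1 / 2 by norm_num,
    Real.rpow_add' (Nat.cast_nonneg n) (by norm_num), Real.rpow_one, ← Real.sqrt_eq_rpow]

theorem Execution.cost_le {n m : ℕ} (hnm : n ≤ m) (hm : m ≤ n.choose 2)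
    {l : List (Sym2 (Fin n))} (hl : l.length = m) {t : ℕ} {σ : State n} (h : Execution l t σ) :
    (t : ℝ) ≤ 12 * (n * √n * √m) := by
  rcases Nat.eq_zero_or_pos n with rfl | hn
  · have hm0 : m = 0 := by simpa using hm
    have := h.mul_le le_rfl
    simp only [hl, hm0] at this
    have : t = 0 := by omega
    simp [this]
  set a := √(n : ℝ) with ha
  set b := √(m : ℝ) with hb
  have ha2 : a * a = n := Real.mul_self_sqrt (Nat.cast_nonneg n)
  have hb2 : b * b = m := Real.mul_self_sqrt (Nat.cast_nonneg m)
  have ha1 : 1 ≤ a := Real.one_le_sqrt.2 (by exact_mod_cast hn)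
  have hab : a ≤ b := Real.sqrt_le_sqrt (by exact_mod_cast hnm)
  have hmn : m ≤ n * n := hm.trans (by
    rw [Nat.choose_two_right]
    exact (Nat.div_le_self _ _).trans (Nat.mul_le_mul_left _ (Nat.sub_le _ _)))
  have hbn : b ≤ n := by
    refine Real.sqrt_le_iff.2 ⟨Nat.cast_nonneg n, ?_⟩
    rw [sq]
    exact_mod_cast hmn
  have ha0 : 0 < a := by linarith
  have hb0 : 0 < b := by linarith
  have hs : 1 ≤ b / a := (one_le_div ha0).2 hab
  -- With `F ≈ √(m/n)` the terms `F n²` and `mn / F` balance. As `n ≤ m`, the quotient is at least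
  -- `1`, so rounding up at most doubles it. The constant is `12 = 2 + 3 * 2 + 4`.
  set F := ⌈b / a⌉₊ with hF
  have hF1 : b / a ≤ F := Nat.le_ceil _
  have hF2 : (F : ℝ) ≤ 2 * (b / a) := by
    have := Nat.ceil_lt_add_one (a := b / a) (by linarith)
    linarith
  have hFpos : 1 ≤ F := by
    have : (1 : ℝ) ≤ F := hs.trans hF1
    exact_mod_cast this
  have key : (F : ℝ) * t ≤ 2 * F * m + 3 * (F * F) * (n * n) + 4 * m * n := by
    have := h.mul_le hFpos
    rw [hl] at this
    exact_mod_cast this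
  have hF0 : (0 : ℝ) < F := by exact_mod_cast hFpos
  have h1 : b ≤ F * a := (div_le_iff₀ ha0).1 hF1
  have h2 : F * a ≤ 2 * b := by
    have := (mul_le_mul_of_nonneg_right hF2 ha0.le)
    rwa [mul_assoc, div_mul_cancel₀ _ ha0.ne'] at this
  have h3 : (m : ℝ) ≤ n * a * b := by
    rw [← hb2]
    have : b ≤ n * a := hbn.trans (le_mul_of_one_le_right (Nat.cast_nonneg n) ha1)
    exact mul_le_mul_of_nonneg_right this hb0.le
  have hn0 : (0 : ℝ) ≤ n := Nat.cast_nonneg n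
  have h4 : (F : ℝ) * F * (n * n) ≤ F * (2 * (n * a * b)) := by
    have e : (F : ℝ) * F * (n * n) = F * (n * a) * (F * a) := by rw [← ha2]; ring
    have e' : (F : ℝ) * (2 * (n * a * b)) = F * (n * a) * (2 * b) := by ring
    rw [e, e']
    exact mul_le_mul_of_nonneg_left h2 (by positivity)
  have h5 : (m : ℝ) * n ≤ F * (n * a * b) := by
    have e : (m : ℝ) * n = n * b * b := by rw [← hb2]; ring
    have e' : (F : ℝ) * (n * a * b) = n * b * (F * a) := by ring
    rw [e, e']
    exact mul_le_mul_of_nonneg_left h1 (by positivity)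
  have h6 : (F : ℝ) * m ≤ F * (n * a * b) := mul_le_mul_of_nonneg_left h3 hF0.le
  refine le_of_mul_le_mul_left ?_ hF0
  linarith

/-- The parameters of the construction for `n` vertices and `m` edges. -/
theorem exists_parameters {n m : ℕ} (hn : 1000 ≤ n) (hnm : n ≤ m) (hm : m ≤ n.choose 2) :
    ∃ Q K R : ℕ, 0 < K ∧ 0 < R ∧ R ≤ Q ∧ layoutSize Q K R ≤ n ∧
      (Q + 1) * (K * (2 * K)) + R * (2 * K) + layoutSize Q K R + 1 ≤ m ∧
      n * n * K ≤ 16384 * (R * (K * (K * (Q - R)))) ∧ m ≤ 64 * (K * K) * n := by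
  -- The `2(Q+1)K²` edges between rows and light vertices must fit into `m`, which suggests `K ≈ √(m
  -- / 16n)`, at least `1`. Then `R ≈ Q / 4K` keeps the `2RK` vertices of the extra rows linear in
  -- `n` and `Q - R` of order `Q`.
  set q := m / (16 * n) with hq
  set K := max 1 (Nat.sqrt q) with hK
  set Q := n / 16 with hQ
  set R := Q / (4 * K) with hR
  have hK1 : 1 ≤ K := le_max_left _ _
  have hm2 : 2 * m ≤ n * n := by
    rw [Nat.choose_two_right] at hm
    have h1 : n * (n - 1) ≤ n * n := Nat.mul_le_mul_left _ (Nat.sub_le _ _)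
    omega
  have hqm : q * (16 * n) ≤ m := Nat.div_mul_le_self _ _
  have hKq : K = 1 ∨ K * K ≤ q := by
    rcases le_total (Nat.sqrt q) 1 with h | h
    · exact Or.inl (max_eq_left h)
    · right
      rw [hK, max_eq_right h]
      exact Nat.sqrt_le q
  have hKm : K = 1 ∨ K * K * (16 * n) ≤ m :=
    hKq.imp_right fun h => (Nat.mul_le_mul_right _ h).trans hqm
  have hKn : 32 * (K * K) ≤ n := by
    rcases hKm with h | h
    · rw [h]
      omega
    · by_contra hlt
      nlinarith
  have hQn : 16 * Q ≤ n ∧ n ≤ 16 * Q + 15 := by omega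
  have h4K : 4 * K ≤ Q := by
    by_contra hlt
    nlinarith
  have hR1 : 1 ≤ R := (Nat.one_le_div_iff (by omega)).2 h4K
  have hR2 : R * (4 * K) ≤ Q := Nat.div_mul_le_self _ _
  have hR3 : Q < (R + 1) * (4 * K) := by
    rw [mul_comm]
    exact Nat.lt_mul_div_succ Q (by omega)
  have hRQ : 4 * R ≤ Q := by nlinarith
  have hKR : K ≤ R * K := Nat.le_mul_of_pos_left _ hR1
  have e1 : layoutSize Q K R = 2 * Q + 2 + 2 * (K * K) + 2 * (R * K) := by
    unfold layoutSize
    ring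
  have e2 : (Q + 1) * (K * (2 * K)) + R * (2 * K) =
      2 * ((Q + 1) * (K * K)) + 2 * (R * K) := by ring
  have hR2' : 4 * (R * K) ≤ Q := by linarith
  have hR3' : Q ≤ 8 * (R * K) := by nlinarith
  refine ⟨Q, K, R, hK1, hR1, by omega, by omega, ?_, ?_, ?_⟩
  · rw [e1, e2]
    rcases hKm with h | h
    · simp only [h, mul_one] at *
      omega
    · have : 8 * ((Q + 1) * (K * K)) ≤ m := by
        refine le_trans ?_ h
        calc 8 * ((Q + 1) * (K * K)) = K * K * (8 * (Q + 1)) := by ring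
          _ ≤ K * K * (16 * n) := Nat.mul_le_mul_left _ (by omega)
      omega
  · have h1 : n ≤ 32 * Q := by omega
    have h2 : Q ≤ 2 * (Q - R) := by omega
    calc n * n * K ≤ (32 * Q) * (32 * Q) * K :=
          Nat.mul_le_mul_right _ (Nat.mul_le_mul h1 h1)
      _ = 1024 * K * (Q * Q) := by ring
      _ ≤ 1024 * K * ((8 * (R * K)) * (2 * (Q - R))) :=
          Nat.mul_le_mul_left _ (Nat.mul_le_mul hR3' h2)
      _ = 16384 * (R * (K * (K * (Q - R)))) := by ring
  · have h1 : m < (q + 1) * (16 * n) := by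
      rw [mul_comm]
      exact Nat.lt_mul_div_succ m (by omega)
    have h2 : q + 1 ≤ (Nat.sqrt q + 1) * (Nat.sqrt q + 1) := Nat.lt_succ_sqrt q
    have h3 : Nat.sqrt q + 1 ≤ 2 * K := by
      have := le_max_right 1 (Nat.sqrt q)
      omega
    calc m ≤ (q + 1) * (16 * n) := h1.le
      _ ≤ (2 * K) * (2 * K) * (16 * n) :=
          Nat.mul_le_mul_right _ (h2.trans (Nat.mul_le_mul h3 h3))
      _ = 64 * (K * K) * n := by ring

theorem exists_reaches_lower {n m : ℕ} (hn : 1000 ≤ n) (hnm : n ≤ m) (hm : m ≤ n.choose 2) :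
    ∃ (E : Finset (Sym2 (Fin n))) (par : Fin n → Option (Fin n)) (t : ℕ),
      Reaches E par t ∧ E.card ≤ m ∧ n * √n * √m ≤ 131072 * (t : ℝ) := by
  obtain ⟨Q, K, R, hK, hR, hRQ, hN, hE, hc, hmK⟩ := exists_parameters hn hnm hm
  obtain ⟨E, par, h1, h2⟩ := exists_reaches_costly (by omega) hN hK hR hRQ
  refine ⟨E, par, _, h1, h2.trans hE, ?_⟩
  have hc' : (n * n * K : ℝ) ≤ 16384 * ((R * (K * (K * (Q - R))) : ℕ) : ℝ) := by
    exact_mod_cast hc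
  have hb : √(m : ℝ) ≤ 8 * K * √n := by
    refine Real.sqrt_le_iff.2 ⟨by positivity, ?_⟩
    rw [mul_pow, Real.sq_sqrt (Nat.cast_nonneg n)]
    calc (m : ℝ) ≤ 64 * (K * K) * n := by exact_mod_cast hmK
      _ = _ := by ring
  calc (n : ℝ) * √n * √m ≤ n * √n * (8 * K * √n) :=
        mul_le_mul_of_nonneg_left hb (by positivity)
    _ = 8 * (n * (√n * √n) * K) := by ring
    _ = 8 * (n * n * K) := by rw [Real.mul_self_sqrt (Nat.cast_nonneg n)]
    _ ≤ _ := by linarith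

/-- For bounded `n` the target is `O(m)`, and the insertions alone cost `m`. -/
theorem bound_le_of_small {n m : ℕ} (hn : n < 1000) : n * √n * √m ≤ 1000000 * (m : ℝ) := by
  have hn' : (n : ℝ) ≤ 1000 := by exact_mod_cast hn.le
  have h1 : √(n : ℝ) ≤ 1000 := Real.sqrt_le_iff.2 ⟨by norm_num, by linarith⟩
  have h2 : √(m : ℝ) ≤ m := by
    refine Real.sqrt_le_iff.2 ⟨Nat.cast_nonneg m, ?_⟩
    exact_mod_cast Nat.le_self_pow (by norm_num) m
  calc (n : ℝ) * √n * √m ≤ 1000 * 1000 * m := by gcongr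
    _ = _ := by norm_num

end ADFS

theorem mainTheorem9 :
    ∃ c C : ℝ, 0 < c ∧ 0 < C ∧ ∀ n m : ℕ, n ≤ m → m ≤ n.choose 2 →
      (∃ l : List (Sym2 (Fin n)), ADFS.IsInsertionSequence n m l ∧
        ∃ (t : ℕ) (σ : ADFS.State n), ADFS.Execution l t σ ∧ σ.Finished ∧
          c * ((n : ℝ) ^ (3 / 2 : ℝ) * (m : ℝ) ^ (1 / 2 : ℝ)) ≤ (t : ℝ) ∧
          (t : ℝ) ≤ C * ((n : ℝ) ^ (3 / 2 : ℝ) * (m : ℝ) ^ (1 / 2 : ℝ))) ∧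
      (∀ l : List (Sym2 (Fin n)), ADFS.IsInsertionSequence n m l →
        ∀ (t : ℕ) (σ : ADFS.State n), ADFS.Execution l t σ →
          (t : ℝ) ≤ C * ((n : ℝ) ^ (3 / 2 : ℝ) * (m : ℝ) ^ (1 / 2 : ℝ))) := by
  refine ⟨1 / 1000000, 12, by norm_num, by norm_num, fun n m hnm hm => ?_⟩
  rw [ADFS.rpow_bound_eq]
  refine ⟨?_, fun l hl t σ h => h.cost_le hnm hm hl.1⟩
  by_cases hn : n < 1000
  · obtain ⟨l, hl, t, σ, -, h, hf⟩ := ADFS.reaches_initial.exists_finished (n := n) (m := m)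
      (by simp) hm
    refine ⟨l, hl, t, σ, h, hf, ?_, h.cost_le hnm hm hl.1⟩
    have hmt := h.length_le
    rw [hl.1, hf.2, List.length_nil, add_zero] at hmt
    have hmt' : (m : ℝ) ≤ t := by exact_mod_cast hmt
    have := ADFS.bound_le_of_small (m := m) hn
    linarith
  · obtain ⟨E, par, t, hR, hE, ht⟩ := ADFS.exists_reaches_lower (not_lt.1 hn) hnm hm
    obtain ⟨l, hl, t', σ, htt', h, hf⟩ := hR.exists_finished hE hm
    refine ⟨l, hl, t', σ, h, hf, ?_, h.cost_le hnm hm hl.1⟩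
    have htt'' : (t : ℝ) ≤ t' := by exact_mod_cast htt'
    have : (0 : ℝ) ≤ t := Nat.cast_nonneg t
    linarith
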